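/- Let $\lambda\in\{1,-1\}$, let $m\ge 1$ and $n\ge 1$ be integers, and let $u:[0,\infty)\to\mathbb R$ satisfy $u\in C^{m+1}([0,\infty))$ and $(1+x)^n\,\partial^i u(x)\in L^1([0,\infty))$ for $i=0,1,\dots,m+1$. Put $\sigma_3=\begin{pmatrix}1&0\\0&-1\end{pmatrix}$, $\mathsf U(x)=\begin{pmatrix}0&u(x)\\ \lambda u(x)&0\end{pmatrix}$ and $e^{z\hat\sigma_3}A=e^{z\sigma_3}Ae^{-z\sigma_3}$ for $z\in\mathbb C$ and $2\times2$ matrices $A$. Consider the Volterra equation $$X(x,k)=I-\int_x^\infty e^{-ik(x'-x)\hat\sigma_3}\,\mathsf U(x')X(x',k)\,dx',\qquad x\ge 0,$$ for a $2\times 2$ matrix $X(x,k)$ whose first column is defined for $\operatorname{Im}k\ge0$ and whose second column is defined for $\operatorname{Im}k\le 0$; a solution is required to have, for each such $k$, columns continuous in $x\ge0$ for which the integrals converge absolutely. (The equation decouples into the two columns.) This equation has exactly one solution $X$. Define $a(k)=X_{22}(0,k)$ and $b(k)=X_{12}(0,k)$ for $\operatorname{Im}k\le0$. Then $X_{11}(0,k)=\overline{a(\bar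 k)}$ and $X_{21}(0,k)=\lambda\,\overline{b(\bar k)}$ for $\operatorname{Im}k\ge 0$, and: (a) $a$ and $b$ are continuous on $\operatorname{Im}k\le0$ and analytic on $\operatorname{Im}k<0$. (b) There exist complex constants $a_1,\dots,a_m,b_1,\dots,b_m$ such that, uniformly as $k\to\infty$ with $\operatorname{Im}k\le0$, $$a(k)=1+\frac{a_1}{k}+\cdots+\frac{a_m}{k^m}+O\Big(\frac1{k^{m+1}}\Big),\qquad b(k)=\frac{b_1}{k}+\cdots+\frac{b_m}{k^m}+O\Big(\frac1{k^{m+1}}\Big).$$ (c) With the same constants, for each $j=1,\dots,n$ the derivatives $a^{(j)}$ and $b^{(j)}$, defined on $\operatorname{Im}k<0$, have continuous extensions to $\operatorname{Im}k\le0$ (denoted by the same symbols), and, uniformly as $k\to\infty$ with $\operatorname{Im}k\le0$, $$a^{(j)}(k)=\frac{d^j}{dk^j}\Big(1+\frac{a_1}{k}+\cdots+\frac{a_m}{k^m}\Big)+O\Big(\frac1{k^{m+1}}\Big),\qquad b^{(j)}(k)=\frac{d^j}{dk^j}\Big(\frac{b_1}{k}+\cdots+\frac{b_m}{k^m}\Big)+O\Big(\frac1{k^{m+1}}\Big).$$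 (d) $a(k)=\overline{a(-\bar k)}$ and $b(k)=\overline{b(-\bar k)}$ for $\operatorname{Im}k\le0$. (e) $|a(k)|^2-\lambda|b(k)|^2=1$ for $k\in\mathbb R$. (f) If $\lambda=1$, then $a(k)\ne0$ for $\operatorname{Im}k\le0$. -/

import Mathlib

open scoped ComplexConjugate

namespace HalfLineTransform

/-- The closed lower half-plane `Im k ≤ 0`. -/
def closedLower : Set ℂ := {k | k.im ≤ 0}

/-- The open lower half-plane `Im k < 0`. -/
def openLower : Set ℂ := {k | k.im < 0}

/-- The set of spectral parameters for which a column of `X(x, k)` is considered: the first column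
(index `0`) on the closed upper half-plane, the second column (index `1`) on the closed lower
half-plane. -/
def columnDomain (c : Fin 2) : Set ℂ :=
  if c = 0 then {k | 0 ≤ k.im} else closedLower

/-- The potential matrix `U(x) = [[0, u(x)], [lam * u(x), 0]]`. -/
noncomputable def potential (lam : ℝ) (u : ℝ → ℝ) (x : ℝ) : Matrix (Fin 2) (Fin 2) ℂ :=
  !![0, (u x : ℂ); (lam : ℂ) * (u x : ℂ), 0]

/-- The matrix `exp (z σ₃) = diag (exp z, exp (-z))`. -/
noncomputable def expSigma (z : ℂ) : Matrix (Fin 2) (Fin 2) ℂ :=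
  !![Complex.exp z, 0; 0, Complex.exp (-z)]

/-- `exp (z ad σ₃) A = exp (z σ₃) A exp (-z σ₃)`. -/
noncomputable def expAdSigma (z : ℂ) (A : Matrix (Fin 2) (Fin 2) ℂ) :
    Matrix (Fin 2) (Fin 2) ℂ :=
  expSigma z * A * expSigma (-z)

/-- The matrix integrand `exp (-i k (t - x) ad σ₃) (U(t) X(t, k))`. Its column `c` depends on `X`
only through column `c` of `X(t, k)`. -/
noncomputable def volterraIntegrand (lam : ℝ) (u : ℝ → ℝ) (X : ℝ → ℂ → Matrix (Fin 2) (Fin 2) ℂ)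
    (k : ℂ) (x t : ℝ) : Matrix (Fin 2) (Fin 2) ℂ :=
  expAdSigma (-Complex.I * k * ((t : ℂ) - (x : ℂ))) (potential lam u t * X t k)

/-- `X` solves `X(x, k) = I + ∫_∞^x exp (-i k (t - x) ad σ₃) (U X)(t, k) dt` for `x ≥ 0`, column by
column: for each column `c` and each `k` in the half-plane belonging to that column, the column is
continuous in `x ≥ 0`, the integrals over `(x, ∞)` converge absolutely, and the equation holds.
Values of `X` elsewhere are irrelevant. -/
def IsVolterraSolution (lam : ℝ) (u : ℝ → ℝ) (X : ℝ → ℂ → Matrix (Fin 2) (Fin 2) ℂ) : Prop :=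
  ∀ c : Fin 2, ∀ k ∈ columnDomain c, ∀ i : Fin 2,
    ContinuousOn (fun x : ℝ => X x k i c) (Set.Ici 0) ∧
    ∀ x : ℝ, 0 ≤ x →
      MeasureTheory.IntegrableOn (fun t : ℝ => volterraIntegrand lam u X k x t i c) (Set.Ioi x) ∧
      X x k i c = (1 : Matrix (Fin 2) (Fin 2) ℂ) i c
        - ∫ t in Set.Ioi x, volterraIntegrand lam u X k x t i c

/-- `a(k)`, the `(2,2)` entry of `s(k) = X(0, k)`, meaningful for `Im k ≤ 0`. -/
def spectralA (X : ℝ → ℂ → Matrix (Fin 2) (Fin 2) ℂ) (k : ℂ) : ℂ := X 0 k 1 1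

/-- `b(k)`, the `(1,2)` entry of `s(k) = X(0, k)`, meaningful for `Im k ≤ 0`. -/
def spectralB (X : ℝ → ℂ → Matrix (Fin 2) (Fin 2) ℂ) (k : ℂ) : ℂ := X 0 k 0 1

/-- The truncated expansion `c₀ + c 1 / k + ⋯ + c m / k ^ m`. -/
noncomputable def truncation (c₀ : ℂ) (c : ℕ → ℂ) (m : ℕ) (k : ℂ) : ℂ :=
  c₀ + ∑ i ∈ Finset.Icc 1 m, c i / k ^ i

/-- `f(k) = O(k ^ (-p))` uniformly as `k → ∞` with `Im k ≤ 0`. -/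
def IsUniformO (f : ℂ → ℂ) (p : ℕ) : Prop :=
  Asymptotics.IsBigO (Bornology.cobounded ℂ ⊓ Filter.principal closedLower)
    f (fun k : ℂ => 1 / k ^ p)

/-- `f` has the expansion `c₀ + c 1 / k + ⋯ + c m / k ^ m + O(k ^ (-m-1))` as `k → ∞` in
`Im k ≤ 0`, and for `j = 1, …, n` the derivative `f⁽ʲ⁾`, taken in `Im k < 0`, has a continuous
extension to `Im k ≤ 0` which there obeys the termwise differentiated expansion with the same
error `O(k ^ (-m-1))`. -/
def HasDifferentiableExpansion (f : ℂ → ℂ) (c₀ : ℂ) (c : ℕ → ℂ) (m n : ℕ) : Prop :=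
  IsUniformO (fun k => f k - truncation c₀ c m k) (m + 1) ∧
  ∀ j ∈ Finset.Icc 1 n, ∃ g : ℂ → ℂ,
    ContinuousOn g closedLower ∧
    Set.EqOn g (iteratedDeriv j f) openLower ∧
    IsUniformO (fun k => g k - iteratedDeriv j (truncation c₀ c m) k) (m + 1)

end HalfLineTransform

open scoped ComplexConjugate
open MeasureTheory Filter Topology Set

namespace HalfLineTransform

/-! ### Tail integrals over `Ioi x`. -/

section Tail

variable {E : Type*} [NormedAddCommGroup E] [NormedSpace ℝ E]

/-! With `p = X₁₂` and `q = X₂₂ - 1`, the second column solves a linear Volterra system with forcing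
`g = u`, namely `p' = 2ikp + uq + g`, `q' = lam u p`, with `p` and `q` vanishing at infinity. The
oscillating kernel has modulus at most 1 for `Im k ≤ 0`. Each `k`-derivative of it costs a factor
`2(t - x)`, so up to `n` derivatives cost at most `(1 + 2t)^n`, which the weight on `u` pays for. In
the norm weighted by `exp(2 ∫_x^∞ w)`, `w = (1 + 2t)^n |u|`, each step of the Neumann series gains a
factor 1/2, for all derivatives up to order `n` at once. This gives existence, continuity,
analyticity and bounds uniform in `k` (`exists_neumannTerm_bound`, `isForcedSolution_forced`); the
same contraction with `w = |u|` gives uniqueness (`IsForcedSolution.unique`).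

The expansion comes from a substitution, not from estimating a formal series. The solution with
forcing `g` is `1/(2ik)` times the sum of an explicit `k`-independent function and the solution of
the same system with a new forcing, one derivative less regular (`forced_recursion`). After `m + 1`
steps the remainder is exactly `k^-(m+1)` times a function whose first `n` derivatives are bounded,
so the Leibniz rule differentiates the expansion (`forced_expansion`,
`hasDifferentiableExpansion_of_jets`).

The symmetries follow from uniqueness, because conjugation maps solutions to solutions when `u` and
`lam` are real and `lam² = 1`. The determinant relation and the absence of zeros follow from the
energy `|X₂₂|² - lam |X₁₂|²`, which tends to 1 at infinity and has derivative `4 lam (Im k) |X₁₂|²`.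
-/

theorem tail_eq_sub {f : ℝ → E} (hi : IntegrableOn f (Ioi 0)) {x : ℝ} (hx : 0 ≤ x) :
    ∫ t in Ioi x, f t = (∫ t in Ioi 0, f t) - ∫ t in (0 : ℝ)..x, f t := by
  rw [← intervalIntegral.integral_Ioi_sub_Ioi hi hx]; abel

theorem tendsto_tail {f : ℝ → E} (hi : IntegrableOn f (Ioi 0)) :
    Tendsto (fun x => ∫ t in Ioi x, f t) atTop (𝓝 0) := by
  have h := (tendsto_const_nhds (x := ∫ t in Ioi 0, f t)).sub
    (intervalIntegral_tendsto_integral_Ioi 0 hi tendsto_id)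
  rw [sub_self] at h
  refine h.congr' ?_
  filter_upwards [eventually_ge_atTop 0] with x hx
  rw [tail_eq_sub hi hx]; rfl

theorem continuousOn_tail {f : ℝ → E} (hi : IntegrableOn f (Ioi 0)) :
    ContinuousOn (fun x => ∫ t in Ioi x, f t) (Ici 0) := by
  intro x hx
  have h1 : IntegrableOn f (uIcc 0 (x + 1)) := by
    rw [uIcc_of_le (by have := mem_Ici.1 hx; linarith), integrableOn_Icc_iff_integrableOn_Ioc]
    exact hi.mono_set Ioc_subset_Ioi_self
  have h2 := (intervalIntegral.continuousOn_primitive_interval h1) x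
    (by rw [uIcc_of_le (by have := mem_Ici.1 hx; linarith)]; exact ⟨hx, by linarith⟩)
  rw [uIcc_of_le (by have := mem_Ici.1 hx; linarith)] at h2
  have h3 : ContinuousWithinAt (fun x => ∫ t in (0 : ℝ)..x, f t) (Ici 0) x := by
    refine h2.mono_of_mem_nhdsWithin ?_
    have := inter_mem_nhdsWithin (Ici (0 : ℝ)) (Iic_mem_nhds (show x < x + 1 by linarith))
    exact this
  refine ((continuousWithinAt_const (b := ∫ t in Ioi 0, f t)).sub h3).congr ?_ ?_
  · intro y hy; exact tail_eq_sub hi hy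
  · exact tail_eq_sub hi hx

theorem hasDerivAt_tail [CompleteSpace E] {f : ℝ → E} (hc : ContinuousOn f (Ici 0))
    (hi : IntegrableOn f (Ioi 0)) {x : ℝ} (hx : 0 < x) :
    HasDerivAt (fun x => ∫ t in Ioi x, f t) (-f x) x := by
  have hcx : ContinuousAt f x := hc.continuousAt (Ici_mem_nhds hx)
  have h1 : IntervalIntegrable f volume 0 x := by
    rw [intervalIntegrable_iff_integrableOn_Ioc_of_le hx.le]
    exact hi.mono_set Ioc_subset_Ioi_self
  have h2 := intervalIntegral.integral_hasDerivAt_right h1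
    ((hc.mono Ioi_subset_Ici_self).stronglyMeasurableAtFilter isOpen_Ioi x hx) hcx
  refine (h2.const_sub (∫ t in Ioi 0, f t)).congr_of_eventuallyEq ?_
  filter_upwards [Ioi_mem_nhds hx] with y hy
  exact tail_eq_sub hi (le_of_lt hy)

theorem norm_tail_le {f : ℝ → E} (hi : IntegrableOn f (Ioi 0)) {x : ℝ} (hx : 0 ≤ x) :
    ‖∫ t in Ioi x, f t‖ ≤ ∫ t in Ioi 0, ‖f t‖ :=
  (norm_integral_le_integral_norm _).trans
    (setIntegral_mono_set hi.norm (Eventually.of_forall fun _ => norm_nonneg _)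
      (Ioi_subset_Ioi hx).eventuallyLE)

end Tail

/-! ### The exponential weight and its contraction inequality. -/

/-- The exponential of twice the tail integral, the weight in which the Volterra iteration
contracts. -/
noncomputable def expTail (w : ℝ → ℝ) (x : ℝ) : ℝ := Real.exp (2 * ∫ t in Ioi x, w t)

theorem expTail_pos (w : ℝ → ℝ) (x : ℝ) : 0 < expTail w x := Real.exp_pos _

section ExpTail

variable {w : ℝ → ℝ} (hc : ContinuousOn w (Ici 0)) (hi : IntegrableOn w (Ioi 0))
  (h0 : ∀ t, 0 ≤ t → 0 ≤ w t)

include hi in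
theorem continuousOn_expTail : ContinuousOn (expTail w) (Ici 0) :=
  ((continuousOn_tail hi).const_smul (2 : ℝ)).rexp

include h0 in
theorem one_le_expTail {x : ℝ} (hx : 0 ≤ x) : 1 ≤ expTail w x := by
  refine Real.one_le_exp (mul_nonneg zero_le_two ?_)
  exact setIntegral_nonneg measurableSet_Ioi fun t ht => h0 t (hx.trans (le_of_lt ht))

include hi h0 in
theorem expTail_le {x : ℝ} (hx : 0 ≤ x) : expTail w x ≤ expTail w 0 := by
  refine Real.exp_le_exp.2 (mul_le_mul_of_nonneg_left ?_ zero_le_two)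
  refine setIntegral_mono_set hi ?_ (Ioi_subset_Ioi hx).eventuallyLE
  filter_upwards [ae_restrict_mem measurableSet_Ioi] with t ht using h0 t (le_of_lt ht)

include hc hi h0 in
theorem integrableOn_mul_expTail : IntegrableOn (fun t => w t * expTail w t) (Ioi 0) := by
  refine Integrable.mono' (hi.mul_const (expTail w 0)) ?_ ?_
  · exact ((hc.mul (continuousOn_expTail hi)).mono Ioi_subset_Ici_self).aestronglyMeasurable
      measurableSet_Ioi
  · filter_upwards [ae_restrict_mem measurableSet_Ioi] with t ht
    have ht' : (0 : ℝ) ≤ t := le_of_lt ht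
    rw [Real.norm_of_nonneg (mul_nonneg (h0 t ht') (expTail_pos w t).le)]
    exact mul_le_mul_of_nonneg_left (expTail_le hi h0 ht') (h0 t ht')

include hc hi h0 in
-- The integrand is minus the derivative of `expTail w / 2`, so the integral equals `(expTail w x -
-- 1) / 2`. The factor 2 in the exponent of the weight is what produces the contraction constant
-- 1/2.
theorem tail_mul_expTail_le {x : ℝ} (hx : 0 ≤ x) :
    ∫ t in Ioi x, w t * expTail w t ≤ expTail w x / 2 := by
  have key : ∫ t in Ioi x, w t * expTail w t = -(1 / 2) - -(expTail w x / 2) := by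
    refine integral_Ioi_of_hasDerivAt_of_tendsto (f := fun t => -(expTail w t / 2)) ?_ ?_
      ((integrableOn_mul_expTail hc hi h0).mono_set (Ioi_subset_Ioi hx)) ?_
    · exact ((((continuousOn_expTail hi).div_const 2).neg) x hx).mono (Ici_subset_Ici.2 hx)
    · intro t ht
      have h := ((((hasDerivAt_tail hc hi (hx.trans_lt ht)).const_mul 2).exp).div_const 2).neg
      refine h.congr_deriv ?_
      simp only [expTail]; ring
    · have h := (((tendsto_tail hi).const_mul 2).rexp.div_const 2).neg
      simpa [expTail] using h
  rw [key]; linarith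

end ExpTail

/-! ### Weighted and bounded regularity classes on the half-line. -/

/-- `r` times continuously differentiable on the half-line, all derivatives up to order `r` being
integrable against the weight `(1 + x) ^ n`. -/
def WeightedDiff (n : ℕ) : ℕ → (ℝ → ℂ) → Prop
  | 0, f => ContinuousOn f (Ici 0) ∧ IntegrableOn (fun x => (1 + x) ^ n * ‖f x‖) (Ioi 0)
  | r + 1, f => (ContinuousOn f (Ici 0) ∧ IntegrableOn (fun x => (1 + x) ^ n * ‖f x‖) (Ioi 0)) ∧
      ∃ f' : ℝ → ℂ, (∀ x, 0 < x → HasDerivAt f (f' x) x) ∧ WeightedDiff n r f'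

/-- `r` times continuously differentiable on the half-line with bounded derivatives. -/
def BoundedDiff : ℕ → (ℝ → ℂ) → Prop
  | 0, f => ContinuousOn f (Ici 0) ∧ ∃ C, ∀ x, 0 ≤ x → ‖f x‖ ≤ C
  | r + 1, f => (ContinuousOn f (Ici 0) ∧ ∃ C, ∀ x, 0 ≤ x → ‖f x‖ ≤ C) ∧
      ∃ f' : ℝ → ℂ, (∀ x, 0 < x → HasDerivAt f (f' x) x) ∧ BoundedDiff r f'

variable {n r : ℕ} {f g : ℝ → ℂ}

theorem WeightedDiff.zero (h : WeightedDiff n r f) : WeightedDiff n 0 f := by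
  cases r with
  | zero => exact h
  | succ r => exact h.1

theorem BoundedDiff.zero (h : BoundedDiff r f) : BoundedDiff 0 f := by
  cases r with
  | zero => exact h
  | succ r => exact h.1

theorem WeightedDiff.continuousOn (h : WeightedDiff n r f) : ContinuousOn f (Ici 0) := h.zero.1

theorem WeightedDiff.integrableOn (h : WeightedDiff n r f) : IntegrableOn f (Ioi 0) := by
  refine Integrable.mono' h.zero.2
    ((h.continuousOn.mono Ioi_subset_Ici_self).aestronglyMeasurable measurableSet_Ioi) ?_
  filter_upwards [ae_restrict_mem measurableSet_Ioi] with t ht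
  have : (1 : ℝ) ≤ (1 + t) ^ n := one_le_pow₀ (by have := mem_Ioi.1 ht; linarith)
  exact le_mul_of_one_le_left (norm_nonneg _) this

theorem WeightedDiff.of_succ (h : WeightedDiff n (r + 1) f) : WeightedDiff n r f := by
  induction r generalizing f with
  | zero => exact h.1
  | succ r ih =>
    obtain ⟨h0, f', hf', h'⟩ := h
    exact ⟨h0, f', hf', ih h'⟩

theorem BoundedDiff.of_succ (h : BoundedDiff (r + 1) f) : BoundedDiff r f := by
  induction r generalizing f with
  | zero => exact h.1
  | succ r ih =>
    obtain ⟨h0, f', hf', h'⟩ := h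
    exact ⟨h0, f', hf', ih h'⟩

theorem WeightedDiff.add (hf : WeightedDiff n r f) (hg : WeightedDiff n r g) :
    WeightedDiff n r (fun x => f x + g x) := by
  have base : ∀ {f g : ℝ → ℂ}, WeightedDiff n 0 f → WeightedDiff n 0 g →
      WeightedDiff n 0 (fun x => f x + g x) := by
    intro f g hf hg
    refine ⟨hf.1.add hg.1, Integrable.mono' (hf.2.add hg.2) ?_ ?_⟩
    · refine ContinuousOn.aestronglyMeasurable ?_ measurableSet_Ioi
      exact (by fun_prop : ContinuousOn (fun x : ℝ => (1 + x) ^ n) _).mul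
        ((hf.1.add hg.1).norm.mono Ioi_subset_Ici_self)
    · filter_upwards [ae_restrict_mem measurableSet_Ioi] with t ht
      have ht' : 0 ≤ (1 + t) ^ n := pow_nonneg (by have := mem_Ioi.1 ht; linarith) _
      rw [Real.norm_of_nonneg (by positivity)]
      refine (mul_le_mul_of_nonneg_left (norm_add_le _ _) ht').trans (le_of_eq ?_)
      simp only [Pi.add_apply]; ring
  induction r generalizing f g with
  | zero => exact base hf hg
  | succ r ih =>
    obtain ⟨f0, f', hf', hf''⟩ := hf
    obtain ⟨g0, g', hg', hg''⟩ := hg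
    exact ⟨base f0 g0, _, fun x hx => (hf' x hx).add (hg' x hx), ih hf'' hg''⟩

theorem WeightedDiff.mul (hf : WeightedDiff n r f) (hg : BoundedDiff r g) :
    WeightedDiff n r (fun x => f x * g x) := by
  have base : ∀ {f g : ℝ → ℂ}, WeightedDiff n 0 f → BoundedDiff 0 g →
      WeightedDiff n 0 (fun x => f x * g x) := by
    rintro f g hf ⟨hg, C, hC⟩
    refine ⟨hf.1.mul hg, Integrable.mono' (hf.2.mul_const C) ?_ ?_⟩
    · refine ContinuousOn.aestronglyMeasurable ?_ measurableSet_Ioi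
      exact (by fun_prop : ContinuousOn (fun x : ℝ => (1 + x) ^ n) _).mul
        ((hf.1.mul hg).norm.mono Ioi_subset_Ici_self)
    · filter_upwards [ae_restrict_mem measurableSet_Ioi] with t ht
      have ht' : 0 ≤ (1 + t) ^ n := pow_nonneg (by have := mem_Ioi.1 ht; linarith) _
      rw [Real.norm_of_nonneg (by positivity), norm_mul, ← mul_assoc]
      exact mul_le_mul_of_nonneg_left (hC t (le_of_lt ht)) (by positivity)
  induction r generalizing f g with
  | zero => exact base hf hg
  | succ r ih =>
    have hf1 := hf.of_succ
    have hg1 := hg.of_succ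
    obtain ⟨f0, f', hf', hf''⟩ := hf
    obtain ⟨g0, g', hg', hg''⟩ := hg
    exact ⟨base f0 g0, _, fun x hx => (hf' x hx).mul (hg' x hx), (ih hf'' hg1).add (ih hf1 hg'')⟩

theorem WeightedDiff.tendsto_zero (h : WeightedDiff n (r + 1) f) : Tendsto f atTop (𝓝 0) := by
  have hi := h.integrableOn
  obtain ⟨-, f', hf', h'⟩ := h
  exact tendsto_zero_of_hasDerivAt_of_integrableOn_Ioi hf' h'.integrableOn hi

theorem bounded_of_tendsto {E : Type*} [NormedAddCommGroup E] {f : ℝ → E} {y : E}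
    (hc : ContinuousOn f (Ici 0)) (h : Tendsto f atTop (𝓝 y)) :
    ∃ C, ∀ x, 0 ≤ x → ‖f x‖ ≤ C := by
  obtain ⟨N, hN⟩ := eventually_atTop.1
    (h.norm.eventually (eventually_le_nhds (show ‖y‖ < ‖y‖ + 1 by linarith)))
  obtain ⟨C, hC⟩ := (isCompact_Icc (a := (0 : ℝ)) (b := N)).exists_bound_of_continuousOn
    (hc.mono Icc_subset_Ici_self)
  refine ⟨max C (‖y‖ + 1), fun x hx => ?_⟩
  rcases le_total x N with h | h
  · exact (hC x ⟨hx, h⟩).trans (le_max_left _ _)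
  · exact (hN x h).trans (le_max_right _ _)

/-- A function that is integrable together with its derivative tends to 0, hence is bounded. One
order is lost because nothing controls the derivative of the top derivative. -/
theorem WeightedDiff.boundedDiff (h : WeightedDiff n (r + 1) f) : BoundedDiff r f := by
  have base : ∀ {r : ℕ} {f : ℝ → ℂ}, WeightedDiff n (r + 1) f → BoundedDiff 0 f := fun h =>
    ⟨h.continuousOn, bounded_of_tendsto h.continuousOn h.tendsto_zero⟩
  induction r generalizing f with
  | zero => exact base h
  | succ r ih =>
    have h0 := base h
    obtain ⟨-, f', hf', h'⟩ := h
    exact ⟨h0, f', hf', ih h'⟩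

theorem WeightedDiff.const_mul (c : ℂ) (hf : WeightedDiff n r f) :
    WeightedDiff n r (fun x => c * f x) := by
  have hb : ∀ (s : ℕ) (c : ℂ), BoundedDiff s (fun _ => c) := by
    intro s
    induction s with
    | zero => exact fun c => ⟨continuousOn_const, ‖c‖, fun _ _ => le_rfl⟩
    | succ s ih => exact fun c => ⟨⟨continuousOn_const, ‖c‖, fun _ _ => le_rfl⟩, fun _ => 0,
        fun x _ => hasDerivAt_const x c, ih 0⟩
  simpa only [mul_comm] using hf.mul (hb r c)

/-- The tail integral of a weighted function is one order more regular. -/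
theorem WeightedDiff.boundedDiff_tail (h : WeightedDiff n (r + 1) f) :
    BoundedDiff (r + 1) (fun x => ∫ t in Ioi x, f t) := by
  refine ⟨⟨continuousOn_tail h.integrableOn, _, fun x hx => norm_tail_le h.integrableOn hx⟩,
    fun x => -1 * f x, fun x hx => ?_, (h.const_mul (-1)).boundedDiff⟩
  simpa using hasDerivAt_tail h.continuousOn h.integrableOn hx

/-- The regularity hypotheses on the potential in recursive form. -/
theorem weightedDiff_of_contDiffOn {u : ℝ → ℝ} {N : ℕ}
    (hu : ContDiffOn ℝ (N : WithTop ℕ∞) u (Ici 0))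
    (hint : ∀ i ≤ N, IntegrableOn
      (fun x : ℝ => (1 + x) ^ n * iteratedDerivWithin i u (Ici 0) x) (Ici 0)) :
    WeightedDiff n N (fun x => (u x : ℂ)) := by
  have hU : UniqueDiffOn ℝ (Ici (0 : ℝ)) := uniqueDiffOn_Ici 0
  have base : ∀ i ≤ N, WeightedDiff n 0
      (fun x => ((iteratedDerivWithin i u (Ici 0) x : ℝ) : ℂ)) := by
    intro i hi
    refine ⟨Complex.continuous_ofReal.comp_continuousOn
      (hu.continuousOn_iteratedDerivWithin (by exact_mod_cast hi) hU), ?_⟩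
    refine IntegrableOn.congr_fun ((hint i hi).mono_set Ioi_subset_Ici_self).norm ?_
      measurableSet_Ioi
    intro t ht
    have ht' : 0 ≤ (1 + t) ^ n := pow_nonneg (by have := mem_Ioi.1 ht; linarith) _
    simp only [norm_mul, Complex.norm_real, Real.norm_of_nonneg ht']
  have key : ∀ s i, i + s = N → WeightedDiff n s
      (fun x => ((iteratedDerivWithin i u (Ici 0) x : ℝ) : ℂ)) := by
    intro s
    induction s with
    | zero => exact fun i hi => base i (by omega)
    | succ s ih =>
      intro i hi
      refine ⟨base i (by omega), _, fun x hx => ?_, ih (i + 1) (by omega)⟩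
      have h1 : DifferentiableWithinAt ℝ (iteratedDerivWithin i u (Ici 0)) (Ici 0) x :=
        hu.differentiableOn_iteratedDerivWithin (by exact_mod_cast (by omega : i < N)) hU x hx.le
      have h2 := h1.hasDerivWithinAt.hasDerivAt (Ici_mem_nhds hx)
      rw [← iteratedDerivWithin_succ] at h2
      exact h2.ofReal_comp
  simpa only [iteratedDerivWithin_zero] using key N 0 (by omega)

/-! ### Half-planes and the Leibniz rule for sequences of derivatives. -/

theorem isOpen_openLower : IsOpen openLower := isOpen_lt Complex.continuous_im continuous_const

theorem openLower_subset : openLower ⊆ closedLower := fun _ hk => le_of_lt (show _ < (0 : ℝ) from hk)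

theorem closedLower_subset_closure : closedLower ⊆ closure openLower := by
  have h := Complex.closure_setOfPred_im_lt 0
  exact h.ge

theorem isPreconnected_openLower : IsPreconnected openLower :=
  (convex_halfSpace_im_lt 0).isPreconnected

/-- The sequence of derivatives of a product, by the Leibniz rule. -/
noncomputable def jetMul (f g : ℕ → ℂ) (j : ℕ) : ℂ :=
  ∑ ij ∈ Finset.HasAntidiagonal.antidiagonal j, (j.choose ij.1 : ℂ) * (f ij.1 * g ij.2)

theorem jetMul_zero (f g : ℕ → ℂ) : jetMul f g 0 = f 0 * g 0 := by simp [jetMul]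

theorem jetMul_succ (f g : ℕ → ℂ) (j : ℕ) :
    jetMul f g (j + 1) = jetMul (fun l => f (l + 1)) g j + jetMul f (fun l => g (l + 1)) j := by
  rw [jetMul, Finset.sum_antidiagonal_choose_succ_mul (fun a b => f a * g b), add_comm]
  congr 1
  refine Finset.sum_congr rfl fun ij hij => ?_
  rw [Nat.choose_symm_of_eq_add (Finset.HasAntidiagonal.mem_antidiagonal.1 hij).symm]

/-- The binomial theorem sums the Leibniz terms. With `s = 2(t - x)` from the oscillating
exponential, this is how the polynomial weight enters. -/
theorem norm_jetMul_le {f g : ℕ → ℂ} {j : ℕ} {s A : ℝ}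
    (hf : ∀ l ≤ j, ‖f l‖ ≤ s ^ l) (hg : ∀ l ≤ j, ‖g l‖ ≤ A) (hs : 0 ≤ s) :
    ‖jetMul f g j‖ ≤ (1 + s) ^ j * A := by
  have h : (1 + s) ^ j * A =
      ∑ ij ∈ Finset.HasAntidiagonal.antidiagonal j, (j.choose ij.1 : ℝ) * (s ^ ij.1 * A) := by
    rw [add_comm, Commute.add_pow' (Commute.all _ _), Finset.sum_mul]
    exact Finset.sum_congr rfl fun ij _ => by rw [nsmul_eq_mul, one_pow]; ring
  rw [h]
  refine norm_sum_le_of_le _ fun ij hij => ?_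
  have h1 := Finset.HasAntidiagonal.antidiagonal.fst_le hij
  have h2 := Finset.HasAntidiagonal.antidiagonal.snd_le hij
  rw [norm_mul, norm_mul, Complex.norm_natCast]
  gcongr
  · exact hf _ h1
  · exact hg _ h2

theorem HasDerivAt.jetMul {f g : ℕ → ℂ → ℂ} {j : ℕ} {k : ℂ}
    (hf : ∀ l ≤ j, HasDerivAt (f l) (f (l + 1) k) k)
    (hg : ∀ l ≤ j, HasDerivAt (g l) (g (l + 1) k) k) :
    HasDerivAt (fun k => jetMul (fun l => f l k) (fun l => g l k) j)
      (jetMul (fun l => f l k) (fun l => g l k) (j + 1)) k := by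
  rw [jetMul_succ, HalfLineTransform.jetMul, HalfLineTransform.jetMul, ← Finset.sum_add_distrib]
  refine HasDerivAt.fun_sum fun ij hij => ?_
  have h := ((hf _ (Finset.HasAntidiagonal.antidiagonal.fst_le hij)).mul
    (hg _ (Finset.HasAntidiagonal.antidiagonal.snd_le hij))).const_mul (j.choose ij.1 : ℂ)
  exact h.congr_deriv (by ring)

theorem ContinuousOn.jetMul {X : Type*} [TopologicalSpace X] {s : Set X} {f g : ℕ → X → ℂ} {j : ℕ}
    (hf : ∀ l ≤ j, ContinuousOn (f l) s) (hg : ∀ l ≤ j, ContinuousOn (g l) s) :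
    ContinuousOn (fun k => jetMul (fun l => f l k) (fun l => g l k) j) s :=
  continuousOn_finsetSum _ fun _ hij => continuousOn_const.mul
    ((hf _ (Finset.HasAntidiagonal.antidiagonal.fst_le hij)).mul (hg _ (Finset.HasAntidiagonal.antidiagonal.snd_le hij)))

/-! ### Families of `k`-derivatives and the Volterra operators acting on them. -/

/-- `f j t k`, for `j ≤ n`, are the successive derivatives in `k` of a function of `t ≥ 0` and of
`k` in the open lower half-plane, extended continuously to the closed one and bounded by `F t`. -/
structure JetFamily (n : ℕ) (f : ℕ → ℝ → ℂ → ℂ) (F : ℝ → ℝ) : Prop where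
  continuousOn_space : ∀ j ≤ n, ∀ k ∈ closedLower, ContinuousOn (fun t => f j t k) (Ici 0)
  continuousOn_param : ∀ j ≤ n, ∀ t, 0 ≤ t → ContinuousOn (f j t) closedLower
  hasDerivAt : ∀ j < n, ∀ t, 0 ≤ t → ∀ k ∈ openLower, HasDerivAt (f j t) (f (j + 1) t k) k
  bound : ∀ j ≤ n, ∀ t, 0 ≤ t → ∀ k ∈ closedLower, ‖f j t k‖ ≤ F t

/-- The derivatives in `k` of `exp (-2 i θ k s)`. -/
noncomputable def oscJet (θ s : ℝ) (l : ℕ) (k : ℂ) : ℂ :=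
  (-2 * Complex.I * θ * s) ^ l * Complex.exp (-2 * Complex.I * θ * s * k)

theorem hasDerivAt_oscJet (θ s : ℝ) (l : ℕ) (k : ℂ) :
    HasDerivAt (oscJet θ s l) (oscJet θ s (l + 1) k) k := by
  have h := (((hasDerivAt_id k).const_mul (-2 * Complex.I * θ * s)).cexp).const_mul
    ((-2 * Complex.I * θ * s) ^ l)
  refine h.congr_deriv ?_
  simp only [oscJet, id]; ring

theorem norm_exp_osc_le {θ s : ℝ} (hθ : 0 ≤ θ) (hs : 0 ≤ s) {k : ℂ} (hk : k ∈ closedLower) :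
    ‖Complex.exp (-2 * Complex.I * θ * s * k)‖ ≤ 1 := by
  have hre : (-2 * Complex.I * θ * s * k).re = 2 * (θ * s) * k.im := by
    simp [Complex.mul_re, Complex.mul_im, mul_assoc]
  rw [Complex.norm_exp, hre, Real.exp_le_one_iff]
  exact mul_nonpos_of_nonneg_of_nonpos (by positivity) hk

theorem norm_oscJet_le {θ s : ℝ} (hθ : 0 ≤ θ) (hθ1 : θ ≤ 1) (hs : 0 ≤ s) (l : ℕ) {k : ℂ}
    (hk : k ∈ closedLower) : ‖oscJet θ s l k‖ ≤ (2 * s) ^ l := by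
  have h2 : ‖-2 * Complex.I * θ * s‖ ≤ 2 * s := by
    simp only [norm_mul, norm_neg, Complex.norm_I, Complex.norm_real, Real.norm_of_nonneg hθ,
      Real.norm_of_nonneg hs, Complex.norm_ofNat, mul_one]
    nlinarith
  rw [oscJet, norm_mul, norm_pow]
  calc _ ≤ (2 * s) ^ l * 1 := by
        gcongr
        exact norm_exp_osc_le hθ hs hk
    _ = _ := mul_one _

/-- The derivatives in `k` of `exp (-2 i θ k (t - x)) f(t, k)`. -/
noncomputable def volterraKernel (θ : ℝ) (f : ℕ → ℝ → ℂ → ℂ) (j : ℕ) (x : ℝ) (k : ℂ) (t : ℝ) : ℂ :=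
  jetMul (fun l => oscJet θ (t - x) l k) (fun l => f l t k) j

/-- The derivatives in `k` of `-∫_x^∞ exp (-2 i θ k (t - x)) f(t, k) dt`. -/
noncomputable def volterraJet (θ : ℝ) (f : ℕ → ℝ → ℂ → ℂ) (j : ℕ) (x : ℝ) (k : ℂ) : ℂ :=
  -∫ t in Ioi x, volterraKernel θ f j x k t

section Volterra

variable {n : ℕ} {θ : ℝ} {f : ℕ → ℝ → ℂ → ℂ} {F : ℝ → ℝ}

theorem JetFamily.norm_kernel_le (hf : JetFamily n f F) (hθ : 0 ≤ θ) (hθ1 : θ ≤ 1) {j : ℕ}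
    (hj : j ≤ n) {x t : ℝ} (hx : 0 ≤ x) (ht : x ≤ t) {k : ℂ} (hk : k ∈ closedLower) :
    ‖volterraKernel θ f j x k t‖ ≤ (1 + 2 * t) ^ n * F t := by
  have ht0 : 0 ≤ t := hx.trans ht
  have hF : 0 ≤ F t := (norm_nonneg _).trans (hf.bound 0 (Nat.zero_le _) t ht0 k hk)
  refine (norm_jetMul_le (s := 2 * (t - x)) (A := F t)
    (fun l _ => norm_oscJet_le hθ hθ1 (sub_nonneg.2 ht) l hk)
    (fun l hl => hf.bound l (hl.trans hj) t ht0 k hk) (by linarith)).trans ?_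
  gcongr
  calc (1 + 2 * (t - x)) ^ j ≤ (1 + 2 * t) ^ j := by
        gcongr
        linarith
    _ ≤ (1 + 2 * t) ^ n := pow_le_pow_right₀ (by linarith) hj

theorem JetFamily.kernel_continuousOn (hf : JetFamily n f F) {j : ℕ}
    (hj : j ≤ n) (x : ℝ) {k : ℂ} (hk : k ∈ closedLower) :
    ContinuousOn (volterraKernel θ f j x k) (Ici 0) := by
  refine ContinuousOn.jetMul (f := fun l t => oscJet θ (t - x) l k) (g := fun l t => f l t k)
    (fun l _ => ?_) fun l hl => hf.continuousOn_space l (hl.trans hj) k hk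
  unfold oscJet
  fun_prop

theorem JetFamily.kernel_integrableOn (hf : JetFamily n f F)
    (hF : IntegrableOn (fun t => (1 + 2 * t) ^ n * F t) (Ioi 0)) (hθ : 0 ≤ θ) (hθ1 : θ ≤ 1) {j : ℕ}
    (hj : j ≤ n) {x : ℝ} (hx : 0 ≤ x) {k : ℂ} (hk : k ∈ closedLower) :
    IntegrableOn (volterraKernel θ f j x k) (Ioi x) := by
  refine Integrable.mono' (hF.mono_set (Ioi_subset_Ioi hx))
    (((hf.kernel_continuousOn hj x hk).mono ((Ioi_subset_Ioi hx).trans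
      Ioi_subset_Ici_self)).aestronglyMeasurable measurableSet_Ioi) ?_
  filter_upwards [ae_restrict_mem measurableSet_Ioi] with t ht
  exact hf.norm_kernel_le hθ hθ1 hj hx (le_of_lt ht) hk

/-- The majorant `(1 + 2t)^n F(t)` depends neither on `x` nor on `k` nor on the order of the
derivative, so dominated convergence gives both continuities and differentiation under the integral.
-/
theorem JetFamily.volterra (hf : JetFamily n f F)
    (hF : IntegrableOn (fun t => (1 + 2 * t) ^ n * F t) (Ioi 0)) (hθ : 0 ≤ θ) (hθ1 : θ ≤ 1) :
    JetFamily n (volterraJet θ f) (fun x => ∫ t in Ioi x, (1 + 2 * t) ^ n * F t) where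
  continuousOn_space := by
    intro j hj k hk
    have heq : ∀ x, volterraJet θ f j x k =
        -∫ t, (Ioi x).indicator (volterraKernel θ f j x k) t := fun x => by
      rw [volterraJet, integral_indicator measurableSet_Ioi]
    simp only [heq]
    refine ContinuousOn.neg fun x₀ hx₀ => ?_
    refine continuousWithinAt_of_dominated
      (bound := (Ioi 0).indicator fun t => (1 + 2 * t) ^ n * F t) ?_ ?_
      ((integrable_indicator_iff measurableSet_Ioi).2 hF) ?_
    · filter_upwards [self_mem_nhdsWithin] with x hx
      exact ((integrable_indicator_iff measurableSet_Ioi).2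
        (hf.kernel_integrableOn hF hθ hθ1 hj hx hk)).aestronglyMeasurable
    · filter_upwards [self_mem_nhdsWithin] with x hx
      have hx : (0 : ℝ) ≤ x := hx
      refine Eventually.of_forall fun t => ?_
      by_cases ht : t ∈ Ioi x
      · rw [indicator_of_mem ht, indicator_of_mem (show t ∈ Ioi (0 : ℝ) from hx.trans_lt ht)]
        exact hf.norm_kernel_le hθ hθ1 hj hx (le_of_lt ht) hk
      · rw [indicator_of_notMem ht, norm_zero]
        refine indicator_nonneg (fun s hs => ?_) t
        have hs : (0 : ℝ) < s := hs
        have : 0 ≤ F s := (norm_nonneg _).trans (hf.bound 0 (Nat.zero_le _) s hs.le k hk)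
        positivity
    · have hne : ∀ᵐ t : ℝ, t ≠ x₀ := by simp [ae_iff, measure_singleton]
      filter_upwards [hne] with t ht
      have hcont : Continuous fun x => volterraKernel θ f j x k t := by
        unfold volterraKernel jetMul oscJet
        fun_prop
      rcases lt_or_gt_of_ne ht with h | h
      · refine (continuousAt_const (y := (0 : ℂ))).congr ?_ |>.continuousWithinAt
        filter_upwards [Ioi_mem_nhds h] with x hx
        rw [indicator_of_notMem (by simpa using le_of_lt hx)]
      · refine hcont.continuousAt.congr ?_ |>.continuousWithinAt
        filter_upwards [Iio_mem_nhds h] with x hx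
        rw [indicator_of_mem (by simpa using hx)]
  continuousOn_param := by
    intro j hj x hx
    refine ContinuousOn.neg (continuousOn_of_dominated
      (bound := fun t => (1 + 2 * t) ^ n * F t) ?_ ?_ (hF.mono_set (Ioi_subset_Ioi hx)) ?_)
    · exact fun k hk => (hf.kernel_integrableOn hF hθ hθ1 hj hx hk).aestronglyMeasurable
    · intro k hk
      filter_upwards [ae_restrict_mem measurableSet_Ioi] with t ht
      exact hf.norm_kernel_le hθ hθ1 hj hx (le_of_lt ht) hk
    · filter_upwards [ae_restrict_mem measurableSet_Ioi] with t ht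
      exact ContinuousOn.jetMul (f := fun l k => oscJet θ (t - x) l k) (g := fun l k => f l t k)
        (fun l _ k _ => (hasDerivAt_oscJet θ (t - x) l k).continuousAt.continuousWithinAt)
        fun l hl => hf.continuousOn_param l (hl.trans hj) t (hx.trans (le_of_lt ht))
  hasDerivAt := by
    intro j hj x hx k hk
    refine HasDerivAt.neg (hasDerivAt_integral_of_dominated_loc_of_deriv_le
      (F' := fun k t => volterraKernel θ f (j + 1) x k t)
      (bound := fun t => (1 + 2 * t) ^ n * F t) (isOpen_openLower.mem_nhds hk) ?_ ?_ ?_ ?_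
      (hF.mono_set (Ioi_subset_Ioi hx)) ?_).2
    · filter_upwards [isOpen_openLower.mem_nhds hk] with k' hk'
      exact (hf.kernel_integrableOn hF hθ hθ1 hj.le hx
        (openLower_subset hk')).aestronglyMeasurable
    · exact hf.kernel_integrableOn hF hθ hθ1 hj.le hx (openLower_subset hk)
    · exact (hf.kernel_integrableOn hF hθ hθ1 hj hx (openLower_subset hk)).aestronglyMeasurable
    · filter_upwards [ae_restrict_mem measurableSet_Ioi] with t ht k' hk'
      exact hf.norm_kernel_le hθ hθ1 hj hx (le_of_lt ht) (openLower_subset hk')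
    · filter_upwards [ae_restrict_mem measurableSet_Ioi] with t ht k' hk'
      exact HasDerivAt.jetMul (f := fun l k => oscJet θ (t - x) l k) (g := fun l k => f l t k)
        (fun l _ => hasDerivAt_oscJet θ (t - x) l k')
        fun l hl => hf.hasDerivAt l (lt_of_le_of_lt hl hj) t (hx.trans (le_of_lt ht)) k' hk'
  bound := by
    intro j hj x hx k hk
    rw [volterraJet, norm_neg]
    refine norm_integral_le_of_norm_le (hF.mono_set (Ioi_subset_Ioi hx)) ?_
    filter_upwards [ae_restrict_mem measurableSet_Ioi] with t ht
    exact hf.norm_kernel_le hθ hθ1 hj hx (le_of_lt ht) hk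

theorem JetFamily.mono {G : ℝ → ℝ} (hf : JetFamily n f F) (h : ∀ t, 0 ≤ t → F t ≤ G t) :
    JetFamily n f G :=
  { hf with bound := fun j hj t ht k hk => (hf.bound j hj t ht k hk).trans (h t ht) }

theorem JetFamily.const_mul (hf : JetFamily n f F) (c : ℂ) :
    JetFamily n (fun j t k => c * f j t k) (fun t => ‖c‖ * F t) where
  continuousOn_space j hj k hk := continuousOn_const.mul (hf.continuousOn_space j hj k hk)
  continuousOn_param j hj t ht := continuousOn_const.mul (hf.continuousOn_param j hj t ht)
  hasDerivAt j hj t ht k hk := (hf.hasDerivAt j hj t ht k hk).const_mul _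
  bound j hj t ht k hk := by
    rw [norm_mul]
    exact mul_le_mul_of_nonneg_left (hf.bound j hj t ht k hk) (norm_nonneg _)

theorem JetFamily.space_mul (hf : JetFamily n f F) {v : ℝ → ℂ} (hv : ContinuousOn v (Ici 0)) :
    JetFamily n (fun j t k => v t * f j t k) (fun t => ‖v t‖ * F t) where
  continuousOn_space j hj k hk := hv.mul (hf.continuousOn_space j hj k hk)
  continuousOn_param j hj t ht := continuousOn_const.mul (hf.continuousOn_param j hj t ht)
  hasDerivAt j hj t ht k hk := (hf.hasDerivAt j hj t ht k hk).const_mul _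
  bound j hj t ht k hk := by
    rw [norm_mul]
    exact mul_le_mul_of_nonneg_left (hf.bound j hj t ht k hk) (norm_nonneg _)

/-- The derivatives in `k` of a function independent of `k`. -/
noncomputable def constJet (g : ℝ → ℂ) (j : ℕ) (t : ℝ) (_ : ℂ) : ℂ := if j = 0 then g t else 0

theorem jetFamily_constJet {g : ℝ → ℂ} (hg : ContinuousOn g (Ici 0)) :
    JetFamily n (constJet g) (fun t => ‖g t‖) where
  continuousOn_space j _ k _ := by
    by_cases h : j = 0
    · simpa [constJet, h] using hg
    · simpa [constJet, h] using continuousOn_const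
  continuousOn_param j _ t _ := continuousOn_const
  hasDerivAt j _ t _ k _ := by
    have : constJet g (j + 1) t k = 0 := by simp [constJet]
    rw [this]
    exact hasDerivAt_const _ _
  bound j _ t _ k _ := by
    by_cases h : j = 0 <;> simp [constJet, h]

/-- A summable majorant common to all orders makes every series of derivatives converge uniformly,
which preserves continuity and permits termwise differentiation. -/
theorem JetFamily.tsum {f : ℕ → ℕ → ℝ → ℂ → ℂ} {M : ℕ → ℝ} (hM : Summable M)
    (hf : ∀ N, JetFamily n (f N) (fun _ => M N)) :
    JetFamily n (fun j t k => ∑' N, f N j t k) (fun _ => ∑' N, M N) where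
  continuousOn_space j hj k hk := continuousOn_tsum (fun N => (hf N).continuousOn_space j hj k hk)
    hM fun N t ht => (hf N).bound j hj t ht k hk
  continuousOn_param j hj t ht := continuousOn_tsum (fun N => (hf N).continuousOn_param j hj t ht)
    hM fun N k hk => (hf N).bound j hj t ht k hk
  hasDerivAt j hj t ht k hk := hasDerivAt_tsum_of_isPreconnected hM isOpen_openLower
    isPreconnected_openLower (fun N k' hk' => (hf N).hasDerivAt j hj t ht k' hk')
    (fun N k' hk' => (hf N).bound (j + 1) hj t ht k' (openLower_subset hk')) hk
    (Summable.of_norm_bounded hM fun N => (hf N).bound j hj.le t ht k (openLower_subset hk)) hk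
  bound j hj t ht k hk :=
    tsum_of_norm_bounded hM.hasSum fun N => (hf N).bound j hj t ht k hk

end Volterra

/-! ### The forced system and its uniqueness. -/

/-- Bounded solutions of `p = -∫_x^∞ exp (-2ik(t-x)) (v q + g) dt`, `q = -lam ∫_x^∞ v p dt`. -/
structure IsForcedSolution (lam : ℝ) (v g : ℝ → ℂ) (k : ℂ) (p q : ℝ → ℂ) : Prop where
  continuousOn_fst : ContinuousOn p (Ici 0)
  continuousOn_snd : ContinuousOn q (Ici 0)
  bounded_fst : ∃ C, ∀ x, 0 ≤ x → ‖p x‖ ≤ C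
  bounded_snd : ∃ C, ∀ x, 0 ≤ x → ‖q x‖ ≤ C
  eq_fst : ∀ x, 0 ≤ x → p x =
    -∫ t in Ioi x, Complex.exp (-2 * Complex.I * k * (t - x : ℝ)) * (v t * q t + g t)
  eq_snd : ∀ x, 0 ≤ x → q x = -lam * ∫ t in Ioi x, v t * p t

theorem norm_exp_le {k : ℂ} (hk : k ∈ closedLower) {x t : ℝ} (h : x ≤ t) :
    ‖Complex.exp (-2 * Complex.I * k * (t - x : ℝ))‖ ≤ 1 := by
  have h1 := norm_exp_osc_le (θ := 1) zero_le_one (sub_nonneg.2 h) hk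
  convert h1 using 3
  push_cast; ring

theorem integrableOn_mul_bounded {v q : ℝ → ℂ} (hv : IntegrableOn v (Ioi 0))
    (hq : ContinuousOn q (Ici 0)) (hb : ∃ C, ∀ x, 0 ≤ x → ‖q x‖ ≤ C) :
    IntegrableOn (fun t => v t * q t) (Ioi 0) := by
  obtain ⟨C, hC⟩ := hb
  refine Integrable.mul_bdd (c := C) hv
    ((hq.mono Ioi_subset_Ici_self).aestronglyMeasurable measurableSet_Ioi) ?_
  filter_upwards [ae_restrict_mem measurableSet_Ioi] with t ht using hC t (le_of_lt ht)

theorem integrableOn_exp_mul {f : ℝ → ℂ} (hf : IntegrableOn f (Ioi 0)) {k : ℂ}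
    (hk : k ∈ closedLower) {x : ℝ} (hx : 0 ≤ x) :
    IntegrableOn (fun t => Complex.exp (-2 * Complex.I * k * (t - x : ℝ)) * f t) (Ioi x) := by
  refine Integrable.bdd_mul (c := 1) (hf.mono_set (Ioi_subset_Ioi hx)) ?_ ?_
  · exact Continuous.aestronglyMeasurable (by fun_prop)
  · filter_upwards [ae_restrict_mem measurableSet_Ioi] with t ht using norm_exp_le hk (le_of_lt ht)

theorem IsForcedSolution.sub {lam : ℝ} {v g g' : ℝ → ℂ} {k : ℂ} {p q p' q' : ℝ → ℂ}
    (hv : IntegrableOn v (Ioi 0)) (hg : IntegrableOn g (Ioi 0)) (hg' : IntegrableOn g' (Ioi 0))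
    (hk : k ∈ closedLower)
    (h : IsForcedSolution lam v g k p q) (h' : IsForcedSolution lam v g' k p' q') :
    IsForcedSolution lam v (fun t => g t - g' t) k (fun x => p x - p' x) (fun x => q x - q' x) where
  continuousOn_fst := h.continuousOn_fst.sub h'.continuousOn_fst
  continuousOn_snd := h.continuousOn_snd.sub h'.continuousOn_snd
  bounded_fst := by
    obtain ⟨C, hC⟩ := h.bounded_fst
    obtain ⟨C', hC'⟩ := h'.bounded_fst
    exact ⟨C + C', fun x hx => (norm_sub_le _ _).trans (add_le_add (hC x hx) (hC' x hx))⟩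
  bounded_snd := by
    obtain ⟨C, hC⟩ := h.bounded_snd
    obtain ⟨C', hC'⟩ := h'.bounded_snd
    exact ⟨C + C', fun x hx => (norm_sub_le _ _).trans (add_le_add (hC x hx) (hC' x hx))⟩
  eq_fst x hx := by
    rw [h.eq_fst x hx, h'.eq_fst x hx, ← neg_sub', ← integral_sub]
    · congr 2; ext t; ring
    · exact integrableOn_exp_mul
        ((integrableOn_mul_bounded hv h.continuousOn_snd h.bounded_snd).add hg) hk hx
    · exact integrableOn_exp_mul
        ((integrableOn_mul_bounded hv h'.continuousOn_snd h'.bounded_snd).add hg') hk hx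
  eq_snd x hx := by
    rw [h.eq_snd x hx, h'.eq_snd x hx, ← mul_sub, ← integral_sub]
    · congr 2; ext t; ring
    · exact (integrableOn_mul_bounded hv h.continuousOn_fst h.bounded_fst).mono_set
        (Ioi_subset_Ioi hx)
    · exact (integrableOn_mul_bounded hv h'.continuousOn_fst h'.bounded_fst).mono_set
        (Ioi_subset_Ioi hx)

/-- Feeding a bound `A * expTail w` on both components into the equations returns it with `A / 2`.
Starting from the boundedness of the solution, the iteration forces it to vanish. -/
theorem IsForcedSolution.eq_zero {lam : ℝ} (hl : |lam| = 1) {v : ℝ → ℂ} {k : ℂ} {p q : ℝ → ℂ}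
    (hvc : ContinuousOn v (Ici 0)) (hv : IntegrableOn v (Ioi 0)) (hk : k ∈ closedLower)
    (h : IsForcedSolution lam v (fun _ => 0) k p q) {x : ℝ} (hx : 0 ≤ x) : p x = 0 ∧ q x = 0 := by
  obtain ⟨C₁, hC₁⟩ := h.bounded_fst
  obtain ⟨C₂, hC₂⟩ := h.bounded_snd
  set w : ℝ → ℝ := fun t => ‖v t‖
  have hwc : ContinuousOn w (Ici 0) := hvc.norm
  have hwi : IntegrableOn w (Ioi 0) := hv.norm
  have hw0 : ∀ t, 0 ≤ t → 0 ≤ w t := fun t _ => norm_nonneg _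
  set C := max C₁ C₂
  have hC0 : 0 ≤ C := (norm_nonneg _).trans ((hC₁ 0 le_rfl).trans (le_max_left _ _))
  have hstep : ∀ {A : ℝ} {f e : ℝ → ℂ}, (∀ t, 0 ≤ t → ‖f t‖ ≤ A * expTail w t) →
      ∀ y, 0 ≤ y → (∀ t, y < t → ‖e t‖ ≤ 1) →
      ‖∫ t in Ioi y, e t * (v t * f t)‖ ≤ A * (1 / 2) * expTail w y := by
    intro A f e hf y hy he
    have hint := ((integrableOn_mul_expTail hwc hwi hw0).mono_set (Ioi_subset_Ioi hy)).const_mul A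
    refine (norm_integral_le_of_norm_le hint ?_).trans ?_
    · filter_upwards [ae_restrict_mem measurableSet_Ioi] with t ht
      rw [norm_mul, norm_mul]
      calc ‖e t‖ * (‖v t‖ * ‖f t‖) ≤ 1 * (‖v t‖ * (A * expTail w t)) := by
            gcongr
            · exact he t ht
            · exact hf t (hy.trans (le_of_lt ht))
        _ = A * (w t * expTail w t) := by ring
    · have hA : 0 ≤ A := by
        have := (norm_nonneg _).trans (hf 0 le_rfl)
        exact nonneg_of_mul_nonneg_left this (expTail_pos _ _)
      rw [integral_const_mul]
      have := mul_le_mul_of_nonneg_left (tail_mul_expTail_le hwc hwi hw0 hy) hA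
      linarith
  have key : ∀ N : ℕ, ∀ y, 0 ≤ y → ‖p y‖ ≤ C * (1 / 2) ^ N * expTail w y ∧
      ‖q y‖ ≤ C * (1 / 2) ^ N * expTail w y := by
    intro N
    induction N with
    | zero =>
      intro y hy
      have h1 := le_mul_of_one_le_right hC0 (one_le_expTail hw0 hy)
      rw [pow_zero, mul_one]
      exact ⟨((hC₁ y hy).trans (le_max_left _ _)).trans h1,
        ((hC₂ y hy).trans (le_max_right _ _)).trans h1⟩
    | succ N ih =>
      intro y hy
      rw [pow_succ, ← mul_assoc]
      constructor
      · rw [h.eq_fst y hy, norm_neg]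
        simp only [add_zero]
        exact hstep (fun t ht => (ih t ht).2) y hy fun t ht => norm_exp_le hk (le_of_lt ht)
      · rw [h.eq_snd y hy, norm_mul, norm_neg, Complex.norm_real, Real.norm_eq_abs, hl, one_mul]
        have := hstep (e := fun _ => 1) (fun t ht => (ih t ht).1) y hy fun t _ => by simp
        simpa only [one_mul] using this
  have hlim : Tendsto (fun N : ℕ => C * (1 / 2) ^ N * expTail w x) atTop (𝓝 0) := by
    have := ((tendsto_pow_atTop_nhds_zero_of_lt_one (r := (1 / 2 : ℝ)) (by norm_num)
      (by norm_num)).const_mul C).mul_const (expTail w x)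
    simpa using this
  constructor <;> rw [← norm_le_zero_iff]
  · exact ge_of_tendsto' hlim fun N => (key N x hx).1
  · exact ge_of_tendsto' hlim fun N => (key N x hx).2

theorem IsForcedSolution.unique {lam : ℝ} (hl : |lam| = 1) {v g : ℝ → ℂ} {k : ℂ} {p q p' q' : ℝ → ℂ}
    (hvc : ContinuousOn v (Ici 0)) (hv : IntegrableOn v (Ioi 0)) (hg : IntegrableOn g (Ioi 0))
    (hk : k ∈ closedLower) (h : IsForcedSolution lam v g k p q)
    (h' : IsForcedSolution lam v g k p' q') {x : ℝ} (hx : 0 ≤ x) : p x = p' x ∧ q x = q' x := by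
  have h0 := h.sub hv hg hg hk h'
  simp only [sub_self] at h0
  obtain ⟨h1, h2⟩ := h0.eq_zero hl hvc hv hk hx
  exact ⟨sub_eq_zero.1 h1, sub_eq_zero.1 h2⟩

/-! ### Existence by the Neumann series. -/

/-- The terms of the Neumann series, with their derivatives in `k`. -/
noncomputable def neumannTerm (lam : ℝ) (v g : ℝ → ℂ) : ℕ → (ℕ → ℝ → ℂ → ℂ) × (ℕ → ℝ → ℂ → ℂ)
  | 0 => (volterraJet 1 (constJet g), fun _ _ _ => 0)
  | N + 1 => (volterraJet 1 (fun j t k => v t * (neumannTerm lam v g N).2 j t k),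
      fun j x k => lam * volterraJet 0 (fun j t k => v t * (neumannTerm lam v g N).1 j t k) j x k)

/-- The first component of the solution of the forced problem, with its derivatives in `k`. -/
noncomputable def forcedFst (lam : ℝ) (v g : ℝ → ℂ) (j : ℕ) (x : ℝ) (k : ℂ) : ℂ :=
  ∑' N, (neumannTerm lam v g N).1 j x k

/-- The second component of the solution of the forced problem, with its derivatives in `k`. -/
noncomputable def forcedSnd (lam : ℝ) (v g : ℝ → ℂ) (j : ℕ) (x : ℝ) (k : ℂ) : ℂ :=
  ∑' N, (neumannTerm lam v g N).2 j x k

theorem volterraJet_zero (θ : ℝ) (f : ℕ → ℝ → ℂ → ℂ) (x : ℝ) (k : ℂ) :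
    volterraJet θ f 0 x k =
      -∫ t in Ioi x, Complex.exp (-2 * Complex.I * (θ * k) * (t - x : ℝ)) * f 0 t k := by
  simp only [volterraJet, volterraKernel, jetMul_zero, oscJet, pow_zero, one_mul]
  congr 3; ext t; congr 2; ring

section Existence

variable {n : ℕ} {lam : ℝ} {v g : ℝ → ℂ}

theorem WeightedDiff.integrableOn_two (hv : WeightedDiff n 0 v) :
    IntegrableOn (fun t : ℝ => (1 + 2 * t) ^ n * ‖v t‖) (Ioi 0) := by
  refine Integrable.mono' (hv.2.const_mul (2 ^ n)) ?_ ?_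
  · refine ContinuousOn.aestronglyMeasurable ?_ measurableSet_Ioi
    exact (by fun_prop : ContinuousOn (fun x : ℝ => (1 + 2 * x) ^ n) _).mul
      (hv.1.norm.mono Ioi_subset_Ici_self)
  · filter_upwards [ae_restrict_mem measurableSet_Ioi] with t ht
    have ht : (0 : ℝ) < t := ht
    rw [Real.norm_of_nonneg (by positivity), ← mul_assoc, ← mul_pow]
    gcongr
    linarith

/-- The derivative weight is absorbed into `w`, so the contraction by 1/2 applies to all orders `j ≤
n` with one constant. The values θ = 1 and θ = 0 treat the oscillating and the non-oscillating
equation together. -/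
theorem exists_neumannTerm_bound (hl : |lam| = 1) (hv : WeightedDiff n 0 v)
    (hg : WeightedDiff n 0 g) : ∃ C : ℝ, ∀ N : ℕ,
      JetFamily n (neumannTerm lam v g N).1 (fun _ => C * (1 / 2) ^ N) ∧
      JetFamily n (neumannTerm lam v g N).2 (fun _ => C * (1 / 2) ^ N) := by
  set w : ℝ → ℝ := fun t => (1 + 2 * t) ^ n * ‖v t‖ with hw
  have hwc : ContinuousOn w (Ici 0) :=
    (by fun_prop : ContinuousOn (fun x : ℝ => (1 + 2 * x) ^ n) _).mul hv.1.norm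
  have hwi : IntegrableOn w (Ioi 0) := hv.integrableOn_two
  have hw0 : ∀ t, 0 ≤ t → 0 ≤ w t := fun t ht => by positivity
  -- `M` bounds the zeroth term and its derivatives, and `1 ≤ expTail w` puts this bound in the
  -- weighted form.
  set M : ℝ := ∫ t in Ioi 0, (1 + 2 * t) ^ n * ‖g t‖
  have hM : 0 ≤ M := setIntegral_nonneg measurableSet_Ioi fun t ht => by
    have ht : (0 : ℝ) < t := ht
    positivity
  have hstep : ∀ {A θ : ℝ} {f : ℕ → ℝ → ℂ → ℂ}, 0 ≤ A → 0 ≤ θ → θ ≤ 1 →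
      JetFamily n f (fun t => A * expTail w t) →
      JetFamily n (volterraJet θ fun j t k => v t * f j t k)
        (fun t => A * (1 / 2) * expTail w t) := by
    intro A θ f hA h0 h1 hf
    have heq : ∀ t, (1 + 2 * t) ^ n * (‖v t‖ * (A * expTail w t)) = A * (w t * expTail w t) :=
      fun t => by rw [hw]; ring
    have hint := (integrableOn_mul_expTail hwc hwi hw0).const_mul A
    refine ((hf.space_mul hv.1).volterra (by simp only [heq]; exact hint) h0 h1).mono ?_
    intro x hx
    simp only [heq]
    rw [integral_const_mul]
    have := mul_le_mul_of_nonneg_left (tail_mul_expTail_le hwc hwi hw0 hx) hA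
    linarith
  have key : ∀ N : ℕ,
      JetFamily n (neumannTerm lam v g N).1 (fun t => M * (1 / 2) ^ N * expTail w t) ∧
      JetFamily n (neumannTerm lam v g N).2 (fun t => M * (1 / 2) ^ N * expTail w t) := by
    intro N
    induction N with
    | zero =>
      refine ⟨((jetFamily_constJet hg.1).volterra hg.integrableOn_two zero_le_one le_rfl).mono ?_,
        ⟨fun j _ k _ => continuousOn_const, fun j _ t _ => continuousOn_const,
          fun j _ t _ k _ => hasDerivAt_const _ _, fun j _ t _ k _ => ?_⟩⟩
      · intro x hx
        rw [pow_zero, mul_one]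
        refine le_trans ?_ (le_mul_of_one_le_right hM (one_le_expTail hw0 hx))
        refine setIntegral_mono_set hg.integrableOn_two ?_ (Ioi_subset_Ioi hx).eventuallyLE
        filter_upwards [ae_restrict_mem measurableSet_Ioi] with t ht
        have ht : (0 : ℝ) < t := ht
        simp only [Pi.zero_apply]
        positivity
      · have := expTail_pos w t
        simp only [neumannTerm, norm_zero]
        positivity
    | succ N ih =>
      have hA : 0 ≤ M * (1 / 2) ^ N := by positivity
      rw [pow_succ, ← mul_assoc]
      refine ⟨hstep hA zero_le_one le_rfl ih.2, ?_⟩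
      refine ((hstep hA le_rfl zero_le_one ih.1).const_mul (lam : ℂ)).mono fun t _ => ?_
      rw [Complex.norm_real, Real.norm_eq_abs, hl, one_mul]
  have hle : ∀ N : ℕ, ∀ t, 0 ≤ t →
      M * (1 / 2) ^ N * expTail w t ≤ M * expTail w 0 * (1 / 2) ^ N := by
    intro N t ht
    have := mul_le_mul_of_nonneg_left (expTail_le hwi hw0 ht)
      (show 0 ≤ M * (1 / 2) ^ N by positivity)
    linarith
  exact ⟨M * expTail w 0, fun N => ⟨(key N).1.mono (hle N), (key N).2.mono (hle N)⟩⟩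

theorem summable_const_mul_half_pow (C : ℝ) : Summable fun N : ℕ => C * (1 / 2) ^ N :=
  (summable_geometric_of_lt_one (by norm_num) (by norm_num)).mul_left C

theorem exists_jetFamily_forced (hl : |lam| = 1) (hv : WeightedDiff n 0 v)
    (hg : WeightedDiff n 0 g) : ∃ C : ℝ,
      JetFamily n (forcedFst lam v g) (fun _ => C) ∧
      JetFamily n (forcedSnd lam v g) (fun _ => C) := by
  obtain ⟨C, hC⟩ := exists_neumannTerm_bound hl hv hg
  have hs := summable_const_mul_half_pow C
  exact ⟨_, JetFamily.tsum hs fun N => (hC N).1, JetFamily.tsum hs fun N => (hC N).2⟩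

/-- The geometric bounds allow sum and integral to be interchanged. Term `N + 1` is the operator
applied to term `N`, and term 0 supplies the forcing. -/
theorem isForcedSolution_forced (hl : |lam| = 1) (hv : WeightedDiff n 0 v)
    (hg : WeightedDiff n 0 g) {k : ℂ} (hk : k ∈ closedLower) :
    IsForcedSolution lam v g k (fun x => forcedFst lam v g 0 x k)
      (fun x => forcedSnd lam v g 0 x k) := by
  obtain ⟨C, hC⟩ := exists_neumannTerm_bound hl hv hg
  obtain ⟨C', hP, hQ⟩ := exists_jetFamily_forced hl hv hg
  have hs := summable_const_mul_half_pow C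
  have hC0 : 0 ≤ C := by
    have := (norm_nonneg _).trans ((hC 0).1.bound 0 (Nat.zero_le _) 0 le_rfl k hk)
    simpa using this
  have hsum : ∀ {f : ℕ → ℕ → ℝ → ℂ → ℂ}, (∀ N, JetFamily n (f N) (fun _ => C * (1 / 2) ^ N)) →
      ∀ (θ : ℝ), 0 ≤ θ → ∀ x, 0 ≤ x →
      HasSum (fun N => volterraJet θ (fun j t k => v t * f N j t k) 0 x k)
        (-∫ t in Ioi x, Complex.exp (-2 * Complex.I * (θ * k) * (t - x : ℝ)) *
          (v t * ∑' N, f N 0 t k)) := by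
    intro f hf θ hθ x hx
    -- Replacing `k` by `θk` lets one kernel estimate serve both equations; at θ = 0 the exponential
    -- is 1.
    have hθk : (θ : ℂ) * k ∈ closedLower := by
      have hk' : k.im ≤ 0 := hk
      change ((θ : ℂ) * k).im ≤ 0
      rw [Complex.im_ofReal_mul]
      exact mul_nonpos_of_nonneg_of_nonpos hθ hk'
    simp only [volterraJet_zero]
    refine HasSum.neg ?_
    simp only [← tsum_mul_left]
    have hint : ∀ N, IntegrableOn (fun t => Complex.exp (-2 * Complex.I * (θ * k) * (t - x : ℝ)) *
        (v t * f N 0 t k)) (Ioi x) := fun N => integrableOn_exp_mul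
      (integrableOn_mul_bounded hv.integrableOn
        ((hf N).continuousOn_space 0 (Nat.zero_le _) k hk)
        ⟨_, fun t ht => (hf N).bound 0 (Nat.zero_le _) t ht k hk⟩) hθk hx
    refine hasSum_integral_of_summable_integral_norm hint ?_
    refine Summable.of_nonneg_of_le (fun N => integral_nonneg fun t => norm_nonneg _)
      (f := fun N => (∫ t in Ioi x, ‖v t‖) * (C * (1 / 2) ^ N)) (fun N => ?_) (hs.mul_left _)
    rw [← integral_mul_const]
    refine setIntegral_mono_on (hint N).norm
      ((hv.integrableOn.mono_set (Ioi_subset_Ioi hx)).norm.mul_const _) measurableSet_Ioi ?_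
    intro t ht
    rw [norm_mul, norm_mul]
    have h1 := norm_exp_le hθk (le_of_lt ht : x ≤ t)
    have h2 := (hf N).bound 0 (Nat.zero_le _) t (hx.trans (le_of_lt ht)) k hk
    calc _ ≤ 1 * (‖v t‖ * (C * (1 / 2) ^ N)) := by gcongr
      _ = _ := one_mul _
  have hsummable : ∀ {f : ℕ → ℕ → ℝ → ℂ → ℂ},
      (∀ N, JetFamily n (f N) (fun _ => C * (1 / 2) ^ N)) →
      ∀ x, 0 ≤ x → Summable fun N => f N 0 x k := fun hf x hx =>
    Summable.of_norm_bounded hs fun N => (hf N).bound 0 (Nat.zero_le _) x hx k hk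
  refine ⟨hP.continuousOn_space 0 (Nat.zero_le _) k hk, hQ.continuousOn_space 0 (Nat.zero_le _) k hk,
    ⟨C', fun x hx => hP.bound 0 (Nat.zero_le _) x hx k hk⟩,
    ⟨C', fun x hx => hQ.bound 0 (Nat.zero_le _) x hx k hk⟩, fun x hx => ?_, fun x hx => ?_⟩
  · have h1 := hsum (fun N => (hC N).2) 1 zero_le_one x hx
    have h2 : forcedFst lam v g 0 x k = _ :=
      (hsummable (fun N => (hC N).1) x hx).tsum_eq_zero_add
    rw [h2]
    have h3 : ∑' N, (neumannTerm lam v g (N + 1)).1 0 x k = _ := h1.tsum_eq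
    rw [h3]
    have h4 : (neumannTerm lam v g 0).1 0 x k = volterraJet 1 (constJet g) 0 x k := rfl
    rw [h4, volterraJet_zero, ← neg_add, ← integral_add]
    · congr 2; ext t
      simp only [constJet, if_true, Complex.ofReal_one, one_mul, forcedSnd]; ring
    · simp only [constJet, if_true, Complex.ofReal_one, one_mul]
      exact integrableOn_exp_mul hg.integrableOn hk hx
    · simp only [Complex.ofReal_one, one_mul]
      exact integrableOn_exp_mul (integrableOn_mul_bounded hv.integrableOn
        (hQ.continuousOn_space 0 (Nat.zero_le _) k hk)
        ⟨C', fun t ht => hQ.bound 0 (Nat.zero_le _) t ht k hk⟩) hk hx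
  · have h1 := (hsum (fun N => (hC N).1) 0 le_rfl x hx).mul_left (lam : ℂ)
    have h2 : forcedSnd lam v g 0 x k = _ :=
      (hsummable (fun N => (hC N).2) x hx).tsum_eq_zero_add
    rw [h2]
    have h3 : ∑' N, (neumannTerm lam v g (N + 1)).2 0 x k = _ := h1.tsum_eq
    rw [h3]
    have h4 : (neumannTerm lam v g 0).2 0 x k = 0 := rfl
    rw [h4, zero_add, mul_neg]
    simp only [Complex.ofReal_zero, zero_mul, mul_zero, Complex.exp_zero, one_mul, neg_mul,
      forcedFst]

end Existence

/-! ### Gaining powers of `1 / k` by changing the forcing. -/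

section Recursion

variable {n r : ℕ} {lam : ℝ} {v g : ℝ → ℂ}

theorem WeightedDiff.boundedDiff_integral_tail (h : WeightedDiff n r g) :
    BoundedDiff r (fun x => ∫ t in Ioi x, g t) := by
  cases r with
  | zero => exact ⟨continuousOn_tail h.integrableOn, _, fun x hx => norm_tail_le h.integrableOn hx⟩
  | succ r => exact h.boundedDiff_tail

/-- Integration by parts in the oscillatory integral. -/
theorem integral_exp_mul_deriv {g g' : ℝ → ℂ} (hc : ContinuousOn g (Ici 0))
    (hd : ∀ x, 0 < x → HasDerivAt g (g' x) x) (hg : IntegrableOn g (Ioi 0))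
    (hg' : IntegrableOn g' (Ioi 0)) (hlim : Tendsto g atTop (𝓝 0)) {k : ℂ}
    (hk : k ∈ closedLower) {x : ℝ} (hx : 0 ≤ x) :
    ∫ t in Ioi x, Complex.exp (-2 * Complex.I * k * (t - x : ℝ)) * g' t =
      2 * Complex.I * k * (∫ t in Ioi x, Complex.exp (-2 * Complex.I * k * (t - x : ℝ)) * g t)
        - g x := by
  have hI := integrableOn_exp_mul hg hk hx
  have hI' := integrableOn_exp_mul hg' hk hx
  have key : ∫ t in Ioi x, (Complex.exp (-2 * Complex.I * k * (t - x : ℝ)) * g' t -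
      2 * Complex.I * k * (Complex.exp (-2 * Complex.I * k * (t - x : ℝ)) * g t)) =
      0 - Complex.exp (-2 * Complex.I * k * (x - x : ℝ)) * g x := by
    refine integral_Ioi_of_hasDerivAt_of_tendsto
      (f := fun t => Complex.exp (-2 * Complex.I * k * (t - x : ℝ)) * g t) ?_ ?_
      (hI'.sub (hI.const_mul _)) ?_
    · exact ContinuousWithinAt.mul (Continuous.continuousWithinAt (by fun_prop))
        ((hc x hx).mono (Ici_subset_Ici.2 hx))
    · intro t ht
      have h1 : HasDerivAt (fun t : ℝ => ((t - x : ℝ) : ℂ)) 1 t := by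
        simpa using ((hasDerivAt_id t).sub_const x).ofReal_comp
      have h2 := ((h1.const_mul (-2 * Complex.I * k)).cexp).mul (hd t (hx.trans_lt ht))
      exact h2.congr_deriv (by ring)
    · refine squeeze_zero_norm' (a := fun t => ‖g t‖) ?_ (by simpa using hlim.norm)
      filter_upwards [eventually_ge_atTop x] with t ht
      rw [norm_mul]
      exact mul_le_of_le_one_left (norm_nonneg _) (norm_exp_le hk ht)
  rw [integral_sub hI' (hI.const_mul _), integral_const_mul] at key
  rw [sub_self, Complex.ofReal_zero, mul_zero, Complex.exp_zero, one_mul, zero_sub] at key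
  rw [sub_eq_iff_eq_add.1 key]; ring

/-- Solving the forced problem gains a factor `1 / k` at the cost of one derivative. -/
theorem forced_recursion (hl : |lam| = 1) (hv : WeightedDiff n (r + 1) v)
    (hg : WeightedDiff n (r + 1) g) : ∃ h : ℝ → ℂ, WeightedDiff n r h ∧ ∃ c₁ c₂ : ℂ,
      ∀ k ∈ closedLower, k ≠ 0 →
        forcedFst lam v g 0 0 k = 1 / (2 * Complex.I * k) * (forcedFst lam v h 0 0 k + c₁) ∧
        forcedSnd lam v g 0 0 k = 1 / (2 * Complex.I * k) * (forcedSnd lam v h 0 0 k + c₂) := by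
  have hvg : WeightedDiff n r (fun t => v t * g t) := hv.of_succ.mul hg.boundedDiff
  -- The substitution is `p = (P - g)/(2ik)`, `q = (Q + lam S)/(2ik)`. Subtracting `g` removes the
  -- forcing from the first equation at the price of `g'`. Since `S' = -v g`, the term `lam S`
  -- restores the second equation to `Q' = lam v P`. The new forcing is therefore `g' + lam v S`.
  set S : ℝ → ℂ := fun x => ∫ t in Ioi x, v t * g t with hS
  have hSB : BoundedDiff r S := hvg.boundedDiff_integral_tail
  have hlim := hg.tendsto_zero
  obtain ⟨-, hgC⟩ := hg.boundedDiff.zero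
  have hgi := hg.integrableOn
  have hgc := hg.continuousOn
  have hgz := hg.zero
  obtain ⟨-, g', hg', hg''⟩ := hg
  have hvS : WeightedDiff n r (fun t => lam * (v t * S t)) := (hv.of_succ.mul hSB).const_mul _
  refine ⟨fun t => g' t + lam * (v t * S t), hg''.add hvS, -g 0, lam * S 0, fun k hk hk0 => ?_⟩
  have hh := isForcedSolution_forced hl hv.zero (hg''.add hvS).zero hk
  set p := fun x => forcedFst lam v (fun t => g' t + lam * (v t * S t)) 0 x k
  set q := fun x => forcedSnd lam v (fun t => g' t + lam * (v t * S t)) 0 x k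
  set κ : ℂ := 1 / (2 * Complex.I * k) with hκ
  have hκ1 : κ * (2 * Complex.I * k) = 1 := by
    rw [hκ]; field_simp
  obtain ⟨Cp, hCp⟩ := hh.bounded_fst
  obtain ⟨Cq, hCq⟩ := hh.bounded_snd
  obtain ⟨Cg, hCg⟩ := hgC
  obtain ⟨-, CS, hCS⟩ := hSB.zero
  have hSc := hSB.zero.1
  -- It suffices that the substituted pair solves the original system, since uniqueness then
  -- identifies it with the forced solution.
  have hnew : IsForcedSolution lam v g k (fun x => κ * (p x + -g x))
      (fun x => κ * (q x + lam * S x)) := by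
    refine ⟨continuousOn_const.mul (hh.continuousOn_fst.add hgc.neg),
      continuousOn_const.mul (hh.continuousOn_snd.add (continuousOn_const.mul hSc)),
      ⟨‖κ‖ * (Cp + Cg), fun x hx => ?_⟩, ⟨‖κ‖ * (Cq + CS), fun x hx => ?_⟩,
      fun x hx => ?_, fun x hx => ?_⟩
    · rw [norm_mul]
      gcongr
      exact (norm_add_le _ _).trans (add_le_add (hCp x hx) (by rw [norm_neg]; exact hCg x hx))
    · rw [norm_mul]
      gcongr
      refine (norm_add_le _ _).trans (add_le_add (hCq x hx) ?_)
      rw [norm_mul, Complex.norm_real, Real.norm_eq_abs, hl, one_mul]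
      exact hCS x hx
    · have i1 := integrableOn_exp_mul (integrableOn_mul_bounded hv.integrableOn
        hh.continuousOn_snd hh.bounded_snd) hk hx
      have i2 := integrableOn_exp_mul hvS.integrableOn hk hx
      have i3 := integrableOn_exp_mul hg''.integrableOn hk hx
      have i4 := integrableOn_exp_mul hgi hk hx
      have e1 : p x = -((∫ t in Ioi x, Complex.exp (-2 * Complex.I * k * (t - x : ℝ)) *
          (v t * q t)) + (∫ t in Ioi x, Complex.exp (-2 * Complex.I * k * (t - x : ℝ)) * g' t) +
          ∫ t in Ioi x, Complex.exp (-2 * Complex.I * k * (t - x : ℝ)) * (lam * (v t * S t))) := by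
        have i13 : IntegrableOn (fun t => Complex.exp (-2 * Complex.I * k * (t - x : ℝ)) *
          (v t * q t) + Complex.exp (-2 * Complex.I * k * (t - x : ℝ)) * g' t) (Ioi x) := i1.add i3
        rw [hh.eq_fst x hx, ← integral_add i1 i3, ← integral_add i13 i2]
        congr 2; ext t; ring
      have e2 : ∫ t in Ioi x, Complex.exp (-2 * Complex.I * k * (t - x : ℝ)) *
          (v t * (κ * (q t + lam * S t)) + g t) =
          κ * (∫ t in Ioi x, Complex.exp (-2 * Complex.I * k * (t - x : ℝ)) * (v t * q t)) +
          κ * (∫ t in Ioi x, Complex.exp (-2 * Complex.I * k * (t - x : ℝ)) *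
            (lam * (v t * S t))) +
          ∫ t in Ioi x, Complex.exp (-2 * Complex.I * k * (t - x : ℝ)) * g t := by
        have i12 : IntegrableOn (fun t => κ * (Complex.exp (-2 * Complex.I * k * (t - x : ℝ)) *
          (v t * q t)) + κ * (Complex.exp (-2 * Complex.I * k * (t - x : ℝ)) *
            (lam * (v t * S t)))) (Ioi x) := (i1.const_mul κ).add (i2.const_mul κ)
        rw [← integral_const_mul, ← integral_const_mul,
          ← integral_add (i1.const_mul κ) (i2.const_mul κ), ← integral_add i12 i4]
        congr 1; ext t; ring
      rw [e1, e2, integral_exp_mul_deriv hgc hg' hgi hg''.integrableOn hlim hk hx]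
      -- After integration by parts, the integrals of the exponential against `g` cancel because `κ
      -- * (2ik) = 1`.
      linear_combination (-∫ t in Ioi x, Complex.exp (-2 * Complex.I * k * (t - x : ℝ)) * g t) * hκ1
    · have i1 := (integrableOn_mul_bounded hv.integrableOn
        hh.continuousOn_fst hh.bounded_fst).mono_set (Ioi_subset_Ioi hx)
      have i2 := hvg.integrableOn.mono_set (Ioi_subset_Ioi hx)
      have e2 : ∫ t in Ioi x, v t * (κ * (p t + -g t)) =
          κ * (∫ t in Ioi x, v t * p t) - κ * ∫ t in Ioi x, v t * g t := by
        rw [← integral_const_mul, ← integral_const_mul,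
          ← integral_sub (i1.const_mul κ) (i2.const_mul κ)]
        congr 1; ext t; ring
      rw [e2, hh.eq_snd x hx, hS]
      ring
  exact (isForcedSolution_forced hl hv.zero hgz hk).unique hl hv.continuousOn hv.integrableOn
    hgi hk hnew le_rfl

/-- The expansion of the forced solution in inverse powers of `k`, with exact remainder. -/
theorem forced_expansion (hl : |lam| = 1) (hv : WeightedDiff n r v) (hg : WeightedDiff n r g) :
    ∃ h : ℝ → ℂ, WeightedDiff n 0 h ∧ ∃ (c : ℂ) (α β : ℕ → ℂ), ∀ k ∈ closedLower, k ≠ 0 →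
      forcedFst lam v g 0 0 k =
        ∑ i ∈ Finset.range r, α i / k ^ (i + 1) + c * forcedFst lam v h 0 0 k / k ^ r ∧
      forcedSnd lam v g 0 0 k =
        ∑ i ∈ Finset.range r, β i / k ^ (i + 1) + c * forcedSnd lam v h 0 0 k / k ^ r := by
  induction r generalizing g with
  | zero => exact ⟨g, hg, 1, 0, 0, fun k _ _ => by simp⟩
  | succ r ih =>
    obtain ⟨g₁, hg₁, c₁, c₂, h₁⟩ := forced_recursion hl hv hg
    obtain ⟨h, hh, c, α, β, h₂⟩ := ih hv.of_succ hg₁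
    set d : ℂ := 1 / (2 * Complex.I) with hd
    -- One recursion step shifts every coefficient by one place and scales it by `d = 1/(2i)`; the
    -- boundary constant `e` becomes the new leading coefficient.
    have hsum : ∀ (α : ℕ → ℂ) (e k R : ℂ), k ≠ 0 →
        1 / (2 * Complex.I * k) *
          ((∑ i ∈ Finset.range r, α i / k ^ (i + 1) + c * R / k ^ r) + e) =
        ∑ i ∈ Finset.range (r + 1), (if i = 0 then d * e else d * α (i - 1)) / k ^ (i + 1) + d * c * R / k ^ (r + 1) := by
      intro α e k R hk
      have h1 : 1 / (2 * Complex.I * k) = d / k := by rw [hd]; field_simp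
      have h2 : ∀ i, d * α i / k ^ (i + 1 + 1) = d / k * (α i / k ^ (i + 1)) := by
        intro i; rw [div_mul_div_comm, pow_succ' k (i + 1)]
      rw [Finset.sum_range_succ', h1]
      simp only [Nat.add_eq_zero_iff, one_ne_zero, and_false, if_false, if_true,
        Nat.add_sub_cancel, h2]
      rw [← Finset.mul_sum, pow_succ' k r]
      field_simp
      ring
    refine ⟨h, hh, d * c, fun i => if i = 0 then d * c₁ else d * α (i - 1),
      fun i => if i = 0 then d * c₂ else d * β (i - 1), fun k hk hk0 => ⟨?_, ?_⟩⟩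
    · rw [(h₁ k hk hk0).1, (h₂ k hk hk0).1]
      exact hsum α c₁ k _ hk0
    · rw [(h₁ k hk hk0).2, (h₂ k hk hk0).2]
      exact hsum β c₂ k _ hk0

end Recursion

/-! ### Differentiating the expansion. -/

section Jets

variable {n : ℕ}

/-- Continuous functions on `S` that on `O` are successive derivatives are determined by the
zeroth one. -/
theorem eqOn_of_jets {S O : Set ℂ} (hO : IsOpen O) (hOS : O ⊆ S) (hcl : S ⊆ closure O)
    {f g : ℕ → ℂ → ℂ} (hfc : ∀ j ≤ n, ContinuousOn (f j) S) (hgc : ∀ j ≤ n, ContinuousOn (g j) S)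
    (hfd : ∀ j < n, ∀ k ∈ O, HasDerivAt (f j) (f (j + 1) k) k)
    (hgd : ∀ j < n, ∀ k ∈ O, HasDerivAt (g j) (g (j + 1) k) k) (h0 : EqOn (f 0) (g 0) O) :
    ∀ j ≤ n, EqOn (f j) (g j) S := by
  have hO' : ∀ j ≤ n, EqOn (f j) (g j) O := by
    intro j
    induction j with
    | zero => exact fun _ => h0
    | succ j ih =>
      intro hj k hk
      have h1 : f j =ᶠ[𝓝 k] g j := (ih (by omega)).eventuallyEq_of_mem (hO.mem_nhds hk)
      exact (hfd j (by omega) k hk).unique ((hgd j (by omega) k hk).congr_of_eventuallyEq h1)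
  exact fun j hj => (hO' j hj).of_subset_closure (hfc j hj) (hgc j hj) hOS hcl

theorem eqOn_iteratedDeriv_of_jets {O : Set ℂ} (hO : IsOpen O) {f : ℕ → ℂ → ℂ}
    (hfd : ∀ j < n, ∀ k ∈ O, HasDerivAt (f j) (f (j + 1) k) k) :
    ∀ j ≤ n, EqOn (f j) (iteratedDeriv j (f 0)) O := by
  intro j
  induction j with
  | zero => exact fun _ k _ => by rw [iteratedDeriv_zero]
  | succ j ih =>
    intro hj k hk
    have h1 : f j =ᶠ[𝓝 k] iteratedDeriv j (f 0) :=
      (ih (by omega)).eventuallyEq_of_mem (hO.mem_nhds hk)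
    rw [iteratedDeriv_succ, ← h1.deriv_eq, (hfd j (by omega) k hk).deriv]

theorem hasDerivAt_iteratedDeriv_truncation (c₀ : ℂ) (c : ℕ → ℂ) (m j : ℕ) {k : ℂ} (hk : k ≠ 0) :
    HasDerivAt (iteratedDeriv j (truncation c₀ c m))
      (iteratedDeriv (j + 1) (truncation c₀ c m) k) k := by
  have h1 : AnalyticAt ℂ (truncation c₀ c m) k := by
    refine analyticAt_const.add (Finset.analyticAt_fun_sum _ fun i _ => ?_)
    exact analyticAt_const.div (analyticAt_id.pow i) (pow_ne_zero i hk)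
  rw [iteratedDeriv_succ, iteratedDeriv_eq_iterate]
  exact (h1.iterated_deriv j).differentiableAt.hasDerivAt

/-- The derivatives of `1 / k ^ M`. -/
noncomputable def invPowJet (M : ℕ) (l : ℕ) (k : ℂ) : ℂ :=
  (∏ i ∈ Finset.range l, (-(M : ℂ) - i)) * k ^ (-(M : ℤ) - l)

theorem hasDerivAt_invPowJet (M l : ℕ) {k : ℂ} (hk : k ≠ 0) :
    HasDerivAt (invPowJet M l) (invPowJet M (l + 1) k) k := by
  have h := (hasDerivAt_zpow (-(M : ℤ) - l) k (Or.inl hk)).const_mul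
    (∏ i ∈ Finset.range l, (-(M : ℂ) - i))
  refine h.congr_deriv ?_
  rw [invPowJet, Finset.prod_range_succ]
  push_cast
  rw [show -(M : ℤ) - (l + 1) = -(M : ℤ) - l - 1 by ring]
  ring

theorem invPowJet_zero (M : ℕ) (k : ℂ) : invPowJet M 0 k = 1 / k ^ M := by
  simp [invPowJet, zpow_neg]

/-- For `|k| ≥ 1` differentiation only lowers the exponent; the extra decay is discarded, since the
error is the same for all orders. -/
theorem isBigO_invPowJet (M l : ℕ) :
    invPowJet M l =O[Bornology.cobounded ℂ ⊓ 𝓟 closedLower] fun k => 1 / k ^ M := by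
  refine Asymptotics.IsBigO.of_bound ‖∏ i ∈ Finset.range l, (-(M : ℂ) - i)‖ ?_
  filter_upwards [(eventually_cobounded_le_norm 1).filter_mono inf_le_left] with k hk
  have hk0 : k ≠ 0 := by
    rintro rfl
    norm_num at hk
  rw [invPowJet, norm_mul]
  gcongr
  rw [sub_eq_add_neg, zpow_add₀ hk0, norm_mul, zpow_neg, zpow_natCast, one_div]
  refine mul_le_of_le_one_right (norm_nonneg _) ?_
  rw [zpow_neg, zpow_natCast, norm_inv, norm_pow]
  exact inv_le_one_of_one_le₀ (one_le_pow₀ hk)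

/-- A function with bounded jets divided by `k ^ (m + 1)` is an admissible remainder. -/
theorem hasDifferentiableExpansion_of_jets {a : ℂ → ℂ} {f G : ℕ → ℂ → ℂ} {c₀ : ℂ} {c : ℕ → ℂ}
    {m : ℕ} {C : ℝ} (hfc : ∀ j ≤ n, ContinuousOn (f j) closedLower)
    (hfd : ∀ j < n, ∀ k ∈ openLower, HasDerivAt (f j) (f (j + 1) k) k)
    (hGc : ∀ j ≤ n, ContinuousOn (G j) closedLower)
    (hGd : ∀ j < n, ∀ k ∈ openLower, HasDerivAt (G j) (G (j + 1) k) k)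
    (hGb : ∀ j ≤ n, ∀ k ∈ closedLower, ‖G j k‖ ≤ C)
    (ha : EqOn a (f 0) closedLower)
    (hf : ∀ k ∈ closedLower, k ≠ 0 → f 0 k = truncation c₀ c m k + G 0 k / k ^ (m + 1)) :
    HasDifferentiableExpansion a c₀ c m n := by
  -- The truncation and the inverse power are singular at 0. The open half-plane is still dense in
  -- `S`, so the differentiated identity passes to the real axis minus 0 by continuity.
  set S : Set ℂ := closedLower \ {0}
  have hne : ∀ k ∈ openLower, k ≠ 0 := by
    rintro k hk rfl
    exact lt_irrefl (0 : ℝ) hk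
  have hOS : openLower ⊆ S := fun k hk => ⟨openLower_subset hk, hne k hk⟩
  have hSc : S ⊆ closure openLower := sdiff_subset.trans closedLower_subset_closure
  set R : ℕ → ℂ → ℂ := fun j k => jetMul (fun l => invPowJet (m + 1) l k) (fun l => G l k) j
  have hEq : ∀ j ≤ n, EqOn (f j) (fun k => iteratedDeriv j (truncation c₀ c m) k + R j k) S := by
    refine eqOn_of_jets isOpen_openLower hOS hSc (fun j hj => (hfc j hj).mono sdiff_subset)
      (fun j hj => ContinuousOn.add ?_ ?_) hfd (fun j hj k hk => HasDerivAt.add ?_ ?_) ?_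
    · exact fun k hk =>
        (hasDerivAt_iteratedDeriv_truncation c₀ c m j hk.2).continuousAt.continuousWithinAt
    · exact ContinuousOn.jetMul
        (fun l _ k hk => (hasDerivAt_invPowJet (m + 1) l hk.2).continuousAt.continuousWithinAt)
        fun l hl => (hGc l (hl.trans hj)).mono sdiff_subset
    · exact hasDerivAt_iteratedDeriv_truncation c₀ c m j (hne k hk)
    · exact HasDerivAt.jetMul (fun l _ => hasDerivAt_invPowJet (m + 1) l (hne k hk))
        fun l hl => hGd l (lt_of_le_of_lt hl hj) k hk
    · intro k hk
      simp only [R, jetMul_zero, invPowJet_zero, iteratedDeriv_zero]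
      rw [hf k (openLower_subset hk) (hne k hk)]
      ring
  have hR : ∀ j ≤ n, IsUniformO (R j) (m + 1) := by
    intro j hj
    refine Asymptotics.IsBigO.fun_sum fun ij hij => Asymptotics.IsBigO.const_mul_left ?_ _
    have h2 : G ij.2 =O[Bornology.cobounded ℂ ⊓ 𝓟 closedLower] fun _ => (1 : ℂ) := by
      refine Asymptotics.IsBigO.of_bound C ?_
      filter_upwards [mem_inf_of_right (mem_principal_self _)] with k hk
      simpa using hGb _ ((Finset.HasAntidiagonal.antidiagonal.snd_le hij).trans hj) k hk
    simpa only [mul_one] using (isBigO_invPowJet (m + 1) ij.1).mul h2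
  have hS : S ∈ Bornology.cobounded ℂ ⊓ 𝓟 closedLower := by
    filter_upwards [mem_inf_of_right (mem_principal_self _),
      (eventually_cobounded_le_norm (1 : ℝ)).filter_mono inf_le_left] with k hk hk1
    refine ⟨hk, ?_⟩
    rintro rfl
    norm_num at hk1
  have hf' : ∀ j ≤ n,
      IsUniformO (fun k => f j k - iteratedDeriv j (truncation c₀ c m) k) (m + 1) := by
    intro j hj
    refine (hR j hj).congr' ?_ EventuallyEq.rfl
    filter_upwards [hS] with k hk
    rw [hEq j hj hk]; ring
  refine ⟨?_, fun j hj => ⟨f j, hfc j (Finset.mem_Icc.1 hj).2, fun k hk => ?_,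
    hf' j (Finset.mem_Icc.1 hj).2⟩⟩
  · refine (hf' 0 (Nat.zero_le _)).congr' ?_ EventuallyEq.rfl
    filter_upwards [hS] with k hk
    rw [iteratedDeriv_zero, ha hk.1]
  · rw [eqOn_iteratedDeriv_of_jets isOpen_openLower hfd j (Finset.mem_Icc.1 hj).2 hk]
    exact ((ha.mono openLower_subset).symm.iteratedDeriv_of_isOpen isOpen_openLower j) hk

/-- The expansion of a bounded jet whose zeroth member has an exact expansion. -/
theorem JetFamily.hasDifferentiableExpansion {a : ℂ → ℂ} {f g : ℕ → ℝ → ℂ → ℂ} {F G : ℝ → ℝ}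
    (hf : JetFamily n f F) (hg : JetFamily n g G) {c₀ c : ℂ} {α : ℕ → ℂ} {m : ℕ}
    (ha : ∀ k ∈ closedLower, a k = c₀ + f 0 0 k)
    (hexp : ∀ k ∈ closedLower, k ≠ 0 → f 0 0 k =
      ∑ i ∈ Finset.range (m + 1), α i / k ^ (i + 1) + c * g 0 0 k / k ^ (m + 1)) :
    HasDifferentiableExpansion a c₀ (fun i => α (i - 1)) m n := by
  -- The exact expansion has `m + 1` coefficients, one more than the truncation keeps. The last one,
  -- `α m / k^(m+1)`, joins the remainder, and constants contribute only to the zeroth derivative.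
  refine hasDifferentiableExpansion_of_jets (C := ‖α m‖ + ‖c‖ * G 0)
    (f := fun j k => (if j = 0 then c₀ else 0) + f j 0 k)
    (G := fun j k => (if j = 0 then α m else 0) + c * g j 0 k) ?_ ?_ ?_ ?_ ?_ ?_ ?_
  · exact fun j hj => continuousOn_const.add (hf.continuousOn_param j hj 0 le_rfl)
  · intro j hj k hk
    simpa using (hf.hasDerivAt j hj 0 le_rfl k hk).const_add (if j = 0 then c₀ else 0)
  · exact fun j hj => continuousOn_const.add
      (continuousOn_const.mul (hg.continuousOn_param j hj 0 le_rfl))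
  · intro j hj k hk
    simpa using ((hg.hasDerivAt j hj 0 le_rfl k hk).const_mul c).const_add
      (if j = 0 then α m else 0)
  · intro j hj k hk
    refine (norm_add_le _ _).trans (add_le_add ?_ ?_)
    · by_cases h : j = 0 <;> simp [h]
    · rw [norm_mul]
      gcongr
      exact hg.bound j hj 0 le_rfl k hk
  · intro k hk
    simpa using ha k hk
  · intro k hk hk0
    have h1 : ∑ i ∈ Finset.Icc 1 m, α (i - 1) / k ^ i =
        ∑ i ∈ Finset.range m, α i / k ^ (i + 1) := by
      have h2 := Finset.sum_Ico_add' (fun i => α (i - 1) / k ^ i) 0 m 1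
      rw [← Finset.range_eq_Ico] at h2
      exact h2.symm
    simp only [if_true, truncation]
    rw [h1, hexp k hk hk0, Finset.sum_range_succ]
    ring

end Jets

/-! ### The differential system and the energy identity. -/

section Energy

variable {lam : ℝ} {v g : ℝ → ℂ} {k : ℂ} {p q : ℝ → ℂ}

theorem IsForcedSolution.hasDerivAt_snd (h : IsForcedSolution lam v g k p q)
    (hvc : ContinuousOn v (Ici 0)) (hv : IntegrableOn v (Ioi 0)) {x : ℝ} (hx : 0 < x) :
    HasDerivAt q (lam * (v x * p x)) x := by
  have h1 := (hasDerivAt_tail (hvc.mul h.continuousOn_fst)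
    (integrableOn_mul_bounded hv h.continuousOn_fst h.bounded_fst) hx).const_mul (-lam : ℂ)
  refine (h1.congr_of_eventuallyEq ?_).congr_deriv (by simp)
  filter_upwards [Ioi_mem_nhds hx] with y hy using h.eq_snd y (le_of_lt hy)

theorem IsForcedSolution.hasDerivAt_fst (h : IsForcedSolution lam v g k p q)
    (hvc : ContinuousOn v (Ici 0)) (hv : IntegrableOn v (Ioi 0))
    (hgc : ContinuousOn g (Ici 0)) (hg : IntegrableOn g (Ioi 0)) (hk : k ∈ closedLower)
    {x : ℝ} (hx : 0 < x) :
    HasDerivAt p (2 * Complex.I * k * p x + (v x * q x + g x)) x := by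
  have hfc : ContinuousOn (fun t => v t * q t + g t) (Ici 0) := (hvc.mul h.continuousOn_snd).add hgc
  have hfi : IntegrableOn (fun t => v t * q t + g t) (Ioi 0) :=
    (integrableOn_mul_bounded hv h.continuousOn_snd h.bounded_snd).add hg
  have hei := integrableOn_exp_mul hfi hk (le_refl (0 : ℝ))
  simp only [sub_zero] at hei
  have hec : ContinuousOn (fun t : ℝ => Complex.exp (-2 * Complex.I * k * t) *
      (v t * q t + g t)) (Ici 0) := ContinuousOn.mul (Continuous.continuousOn (by fun_prop)) hfc
  -- Factoring the exponential leaves an integrand independent of the endpoint, so the tail can be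
  -- differentiated without differentiating under the integral.
  have heq : ∀ y, 0 ≤ y → p y = Complex.exp (2 * Complex.I * k * y) *
      -∫ t in Ioi y, Complex.exp (-2 * Complex.I * k * t) * (v t * q t + g t) := by
    intro y hy
    rw [h.eq_fst y hy, mul_neg, ← integral_const_mul]
    congr 2; ext t
    rw [← mul_assoc, ← Complex.exp_add]
    congr 2; push_cast; ring
  have h1 : HasDerivAt (fun t : ℝ => (t : ℂ)) 1 x := by
    simpa using (hasDerivAt_id x).ofReal_comp
  have h2 := ((h1.const_mul (2 * Complex.I * k)).cexp).mul (hasDerivAt_tail hec hei hx).neg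
  refine (h2.congr_of_eventuallyEq ?_).congr_deriv ?_
  · filter_upwards [Ioi_mem_nhds hx] with y hy using heq y (le_of_lt hy)
  · have h3 : Complex.exp (2 * Complex.I * k * x) * Complex.exp (-2 * Complex.I * k * x) = 1 := by
      rw [← Complex.exp_add, ← Complex.exp_zero]
      congr 1; ring
    rw [heq x hx.le]
    simp only [Pi.neg_apply]
    linear_combination (v x * q x + g x) * h3

theorem IsForcedSolution.tendsto_snd (h : IsForcedSolution lam v g k p q)
    (hv : IntegrableOn v (Ioi 0)) : Tendsto q atTop (𝓝 0) := by
  have h1 := (tendsto_tail (integrableOn_mul_bounded hv h.continuousOn_fst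
    h.bounded_fst)).const_mul (-lam : ℂ)
  rw [mul_zero] at h1
  refine h1.congr' ?_
  filter_upwards [eventually_ge_atTop 0] with x hx using (h.eq_snd x hx).symm

theorem IsForcedSolution.tendsto_fst (h : IsForcedSolution lam v g k p q)
    (hv : IntegrableOn v (Ioi 0)) (hg : IntegrableOn g (Ioi 0)) (hk : k ∈ closedLower) :
    Tendsto p atTop (𝓝 0) := by
  have hfi : IntegrableOn (fun t => v t * q t + g t) (Ioi 0) :=
    (integrableOn_mul_bounded hv h.continuousOn_snd h.bounded_snd).add hg
  have hfn : IntegrableOn (fun t => ‖v t * q t + g t‖) (Ioi 0) := hfi.norm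
  refine squeeze_zero_norm' ?_ (tendsto_tail hfn)
  filter_upwards [eventually_ge_atTop 0] with x hx
  rw [h.eq_fst x hx, norm_neg]
  refine norm_integral_le_of_norm_le (hfn.mono_set (Ioi_subset_Ioi hx)) ?_
  filter_upwards [ae_restrict_mem measurableSet_Ioi] with t ht
  rw [norm_mul]
  exact mul_le_of_le_one_left (norm_nonneg _) (norm_exp_le hk (le_of_lt ht))

/-- The energy `|1 + q|² - lam |p|²` of a column. -/
noncomputable def energy (lam : ℝ) (p q : ℝ → ℂ) (x : ℝ) : ℝ :=
  Complex.normSq (1 + q x) - lam * Complex.normSq (p x)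

variable {u : ℝ → ℝ}

theorem hasDerivAt_normSq {f : ℝ → ℂ} {f' : ℂ} {x : ℝ} (h : HasDerivAt f f' x) :
    HasDerivAt (fun x => Complex.normSq (f x)) (2 * (f' * conj (f x)).re) x := by
  have h1 : HasDerivAt (fun x => (f x).re) f'.re x :=
    Complex.reCLM.hasFDerivAt.comp_hasDerivAt x h
  have h2 : HasDerivAt (fun x => (f x).im) f'.im x :=
    Complex.imCLM.hasFDerivAt.comp_hasDerivAt x h
  have h3 := (h1.mul h1).add (h2.mul h2)
  refine h3.congr_deriv ?_
  simp [Complex.mul_re]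
  ring

/-- With forcing equal to the potential, the first equation reads `p' = 2ikp + u(1 + q)`. As `u` is
real, the cross terms in `|1 + q|²` and `lam |p|²` cancel, leaving only the contribution of `2ik
|p|²`. -/
theorem hasDerivAt_energy (h : IsForcedSolution lam (fun x => (u x : ℂ)) (fun x => (u x : ℂ)) k p q)
    (huc : ContinuousOn (fun x => (u x : ℂ)) (Ici 0))
    (hu : IntegrableOn (fun x => (u x : ℂ)) (Ioi 0)) (hk : k ∈ closedLower)
    {x : ℝ} (hx : 0 < x) :
    HasDerivAt (energy lam p q) (4 * lam * k.im * Complex.normSq (p x)) x := by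
  have h1 := hasDerivAt_normSq ((h.hasDerivAt_snd huc hu hx).const_add 1)
  have h2 := (hasDerivAt_normSq (h.hasDerivAt_fst huc hu huc hu hk hx)).const_mul lam
  refine (h1.sub h2).congr_deriv ?_
  simp [Complex.mul_re, Complex.mul_im, Complex.normSq_apply]
  ring

theorem continuousOn_energy (h : IsForcedSolution lam v g k p q) :
    ContinuousOn (energy lam p q) (Ici 0) :=
  (Complex.continuous_normSq.comp_continuousOn (continuousOn_const.add h.continuousOn_snd)).sub
    (continuousOn_const.mul (Complex.continuous_normSq.comp_continuousOn h.continuousOn_fst))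

theorem tendsto_energy (h : IsForcedSolution lam v g k p q)
    (hv : IntegrableOn v (Ioi 0)) (hg : IntegrableOn g (Ioi 0)) (hk : k ∈ closedLower) :
    Tendsto (energy lam p q) atTop (𝓝 1) := by
  have h1 := (Complex.continuous_normSq.tendsto _).comp ((h.tendsto_snd hv).const_add 1)
  have h2 := ((Complex.continuous_normSq.tendsto _).comp (h.tendsto_fst hv hg hk)).const_mul lam
  have h3 := h1.sub h2
  simp only [add_zero, map_one, map_zero, mul_zero, sub_zero] at h3
  exact h3

/-- Under the sign condition the energy is nonincreasing, with limit 1 at infinity. The condition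
holds for real `k` with either sign of `lam`, and on the whole closed half-plane when `lam = 1`. -/
theorem one_le_energy (h : IsForcedSolution lam (fun x => (u x : ℂ)) (fun x => (u x : ℂ)) k p q)
    (huc : ContinuousOn (fun x => (u x : ℂ)) (Ici 0))
    (hu : IntegrableOn (fun x => (u x : ℂ)) (Ioi 0)) (hk : k ∈ closedLower)
    (hs : lam * k.im ≤ 0) : 1 ≤ energy lam p q 0 := by
  have hanti : AntitoneOn (energy lam p q) (Ici 0) := by
    refine antitoneOn_of_deriv_nonpos (convex_Ici 0) (continuousOn_energy h) ?_ ?_ <;>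
      rw [interior_Ici]
    · exact fun x hx => (hasDerivAt_energy h huc hu hk hx).differentiableAt.differentiableWithinAt
    · intro x hx
      rw [(hasDerivAt_energy h huc hu hk hx).deriv]
      nlinarith [Complex.normSq_nonneg (p x)]
  refine le_of_tendsto (tendsto_energy h hu hu hk) ?_
  filter_upwards [eventually_ge_atTop 0] with x hx using hanti (mem_Ici.2 le_rfl) hx hx

theorem energy_eq_one (h : IsForcedSolution lam (fun x => (u x : ℂ)) (fun x => (u x : ℂ)) k p q)
    (huc : ContinuousOn (fun x => (u x : ℂ)) (Ici 0))
    (hu : IntegrableOn (fun x => (u x : ℂ)) (Ioi 0)) (hk : k.im = 0) : energy lam p q 0 = 1 := by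
  have hkL : k ∈ closedLower := hk.le
  refine le_antisymm ?_ (one_le_energy h huc hu hkL (by rw [hk, mul_zero]))
  have hmono : MonotoneOn (energy lam p q) (Ici 0) := by
    refine monotoneOn_of_deriv_nonneg (convex_Ici 0) (continuousOn_energy h) ?_ ?_ <;>
      rw [interior_Ici]
    · exact fun x hx => (hasDerivAt_energy h huc hu hkL hx).differentiableAt.differentiableWithinAt
    · intro x hx
      rw [(hasDerivAt_energy h huc hu hkL hx).deriv, hk, mul_zero, zero_mul]
  refine ge_of_tendsto (tendsto_energy h hu hu hkL) ?_
  filter_upwards [eventually_ge_atTop 0] with x hx using hmono (mem_Ici.2 le_rfl) hx hx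

end Energy

/-! ### From matrix columns to the forced system, and the symmetries. -/

section Columns

variable {n : ℕ} {lam : ℝ} {u : ℝ → ℝ} {X : ℝ → ℂ → Matrix (Fin 2) (Fin 2) ℂ} {k : ℂ}

theorem volterraIntegrand_zero_zero (x t : ℝ) :
    volterraIntegrand lam u X k x t 0 0 = u t * X t k 1 0 := by
  simp only [volterraIntegrand, expAdSigma, expSigma, potential, Matrix.mul_apply, Fin.sum_univ_two,
    Matrix.of_apply, Matrix.cons_val', Matrix.cons_val_zero, Matrix.cons_val_one,
    Matrix.cons_val_fin_one, zero_mul, mul_zero, zero_add, add_zero]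
  rw [mul_right_comm, ← Complex.exp_add, add_neg_cancel, Complex.exp_zero, one_mul]

theorem volterraIntegrand_one_one (x t : ℝ) :
    volterraIntegrand lam u X k x t 1 1 = lam * (u t * X t k 0 1) := by
  simp only [volterraIntegrand, expAdSigma, expSigma, potential, Matrix.mul_apply, Fin.sum_univ_two,
    Matrix.of_apply, Matrix.cons_val', Matrix.cons_val_zero, Matrix.cons_val_one,
    Matrix.cons_val_fin_one, zero_mul, mul_zero, zero_add, add_zero]
  rw [mul_right_comm, ← Complex.exp_add, add_neg_cancel, Complex.exp_zero, one_mul, mul_assoc]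

theorem volterraIntegrand_zero_one (x t : ℝ) :
    volterraIntegrand lam u X k x t 0 1 =
      Complex.exp (-2 * Complex.I * k * (t - x : ℝ)) * (u t * X t k 1 1) := by
  simp only [volterraIntegrand, expAdSigma, expSigma, potential, Matrix.mul_apply, Fin.sum_univ_two,
    Matrix.of_apply, Matrix.cons_val', Matrix.cons_val_zero, Matrix.cons_val_one,
    Matrix.cons_val_fin_one, zero_mul, mul_zero, zero_add, add_zero]
  rw [mul_right_comm, ← Complex.exp_add]
  congr 2; push_cast; ring

theorem volterraIntegrand_one_zero (x t : ℝ) :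
    volterraIntegrand lam u X k x t 1 0 =
      Complex.exp (2 * Complex.I * k * (t - x : ℝ)) * (lam * (u t * X t k 0 0)) := by
  simp only [volterraIntegrand, expAdSigma, expSigma, potential, Matrix.mul_apply, Fin.sum_univ_two,
    Matrix.of_apply, Matrix.cons_val', Matrix.cons_val_zero, Matrix.cons_val_one,
    Matrix.cons_val_fin_one, zero_mul, mul_zero, zero_add, add_zero]
  rw [mul_right_comm, ← Complex.exp_add, mul_assoc (lam : ℂ)]
  congr 2; push_cast; ring

theorem conj_exp_osc (k : ℂ) (s : ℝ) :
    conj (Complex.exp (-2 * Complex.I * k * s)) = Complex.exp (2 * Complex.I * conj k * s) := by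
  rw [← Complex.exp_conj]
  simp [Complex.conj_ofNat]

theorem integrableOn_conj {f : ℝ → ℂ} {s : Set ℝ} (hf : IntegrableOn f s) :
    IntegrableOn (fun t => conj (f t)) s :=
  Complex.conjCLE.toContinuousLinearMap.integrable_comp hf

/-- A column solving the Volterra equation is automatically bounded. -/
theorem isForcedSolution_of_column (hu : IntegrableOn (fun t => (u t : ℂ)) (Ioi 0))
    (hk : k ∈ closedLower) {p q : ℝ → ℂ} (hp : ContinuousOn p (Ici 0)) (hq : ContinuousOn q (Ici 0))
    (hi : IntegrableOn (fun t => u t * p t) (Ioi 0))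
    (hep : ∀ x, 0 ≤ x → p x =
      -∫ t in Ioi x, Complex.exp (-2 * Complex.I * k * (t - x : ℝ)) * (u t * q t))
    (heq : ∀ x, 0 ≤ x → q x = 1 - lam * ∫ t in Ioi x, u t * p t) :
    IsForcedSolution lam (fun t => (u t : ℂ)) (fun t => (u t : ℂ)) k p (fun x => q x - 1) := by
  -- Absolute convergence of the non-oscillating integral bounds `q` before anything is known about
  -- `p`; integrating `u q` then bounds `p`.
  have hqb : ∃ C, ∀ x, 0 ≤ x → ‖q x‖ ≤ C := by
    refine ⟨1 + |lam| * ∫ t in Ioi 0, ‖(u t : ℂ) * p t‖, fun x hx => ?_⟩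
    rw [heq x hx]
    refine (norm_sub_le _ _).trans (add_le_add (by simp) ?_)
    rw [norm_mul, Complex.norm_real, Real.norm_eq_abs]
    exact mul_le_mul_of_nonneg_left (norm_tail_le hi hx) (abs_nonneg _)
  have huq := integrableOn_mul_bounded hu hq hqb
  refine ⟨hp, hq.sub continuousOn_const, ⟨∫ t in Ioi 0, ‖(u t : ℂ) * q t‖, fun x hx => ?_⟩, ?_,
    fun x hx => ?_, fun x hx => ?_⟩
  · have huq' : IntegrableOn (fun t => ‖(u t : ℂ) * q t‖) (Ioi 0) := huq.norm
    rw [hep x hx, norm_neg]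
    refine (norm_integral_le_of_norm_le (huq'.mono_set (Ioi_subset_Ioi hx)) ?_).trans
      (setIntegral_mono_set huq' (Eventually.of_forall fun _ => norm_nonneg _)
        (Ioi_subset_Ioi hx).eventuallyLE)
    filter_upwards [ae_restrict_mem measurableSet_Ioi] with t ht
    rw [norm_mul]
    exact mul_le_of_le_one_left (norm_nonneg _) (norm_exp_le hk (le_of_lt ht))
  · obtain ⟨C, hC⟩ := hqb
    exact ⟨C + ‖(1 : ℂ)‖, fun x hx => (norm_sub_le _ _).trans (add_le_add (hC x hx) le_rfl)⟩
  · rw [hep x hx]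
    congr 2; ext t; ring
  · rw [heq x hx]; ring

variable (hu : IntegrableOn (fun t => (u t : ℂ)) (Ioi 0))

include hu in
theorem IsVolterraSolution.second_column (hX : IsVolterraSolution lam u X) (hl : |lam| = 1)
    (hk : k ∈ closedLower) :
    IsForcedSolution lam (fun t => (u t : ℂ)) (fun t => (u t : ℂ)) k (fun x => X x k 0 1)
      (fun x => X x k 1 1 - 1) := by
  have hk' : k ∈ columnDomain 1 := by simpa [columnDomain] using hk
  obtain ⟨hpc, hp⟩ := hX 1 k hk' 0
  obtain ⟨hqc, hq⟩ := hX 1 k hk' 1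
  simp only [volterraIntegrand_zero_one, Matrix.one_apply, zero_ne_one, if_false, zero_sub] at hp
  simp only [volterraIntegrand_one_one, Matrix.one_apply_eq, integral_const_mul] at hq
  have hl0 : (lam : ℂ) ≠ 0 := by
    rw [Complex.ofReal_ne_zero]
    rintro rfl
    simp at hl
  refine isForcedSolution_of_column hu hk hpc hqc ?_ (fun x hx => (hp x hx).2)
    fun x hx => (hq x hx).2
  refine (((hq 0 le_rfl).1.const_mul (lam : ℂ)⁻¹)).congr (Eventually.of_forall fun t => ?_)
  simp only
  rw [inv_mul_cancel_left₀ hl0]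

include hu in
-- Conjugating the equations at `conj k` reverses the sign of the exponent, and `lam² = 1` moves
-- `lam` from one equation to the other, which yields the second-column system at `k`.
theorem IsVolterraSolution.first_column (hX : IsVolterraSolution lam u X) (hl : |lam| = 1)
    (hk : k ∈ closedLower) :
    IsForcedSolution lam (fun t => (u t : ℂ)) (fun t => (u t : ℂ)) k
      (fun x => lam * conj (X x (conj k) 1 0)) (fun x => conj (X x (conj k) 0 0) - 1) := by
  have hk' : conj k ∈ columnDomain 0 := by
    have : k.im ≤ 0 := hk
    simpa [columnDomain] using this
  have hl2 : (lam : ℂ) * lam = 1 := by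
    rw [← Complex.ofReal_mul, ← abs_mul_abs_self, hl]; simp
  obtain ⟨hqc, hq⟩ := hX 0 (conj k) hk' 0
  obtain ⟨hpc, hp⟩ := hX 0 (conj k) hk' 1
  simp only [volterraIntegrand_one_zero, Matrix.one_apply, one_ne_zero, if_false, zero_sub] at hp
  simp only [volterraIntegrand_zero_zero, Matrix.one_apply_eq] at hq
  refine isForcedSolution_of_column hu hk
    (continuousOn_const.mul (Complex.continuous_conj.comp_continuousOn hpc))
    (Complex.continuous_conj.comp_continuousOn hqc) ?_ (fun x hx => ?_) fun x hx => ?_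
  · refine ((integrableOn_conj (hq 0 le_rfl).1).const_mul (lam : ℂ)).congr
      (Eventually.of_forall fun t => ?_)
    simp only [map_mul, Complex.conj_ofReal]
    ring
  · rw [(hp x hx).2, map_neg, ← integral_conj, mul_neg, ← integral_const_mul]
    congr 2; ext t
    rw [← conj_exp_osc]
    simp only [map_mul, Complex.conj_conj, Complex.conj_ofReal]
    linear_combination (Complex.exp (-2 * Complex.I * k * (t - x : ℝ)) * u t *
      conj (X t (conj k) 0 0)) * hl2
  · rw [(hq x hx).2, map_sub, map_one, ← integral_conj, ← integral_const_mul]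
    congr 2; ext t
    simp only [map_mul, Complex.conj_ofReal]
    linear_combination (-(u t * conj (X t (conj k) 1 0))) * hl2

/-- The map `k ↦ -conj k` preserves the lower half-plane, and conjugation carries the exponential at
`-conj k` to the one at `k`; `u` and `lam` are real. -/
theorem IsForcedSolution.conj {p q : ℝ → ℂ} (h : IsForcedSolution lam (fun t => (u t : ℂ))
      (fun t => (u t : ℂ)) (-conj k) p q) :
    IsForcedSolution lam (fun t => (u t : ℂ)) (fun t => (u t : ℂ)) k
      (fun x => conj (p x)) (fun x => conj (q x)) where
  continuousOn_fst := Complex.continuous_conj.comp_continuousOn h.continuousOn_fst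
  continuousOn_snd := Complex.continuous_conj.comp_continuousOn h.continuousOn_snd
  bounded_fst := by simpa only [Complex.norm_conj] using h.bounded_fst
  bounded_snd := by simpa only [Complex.norm_conj] using h.bounded_snd
  eq_fst x hx := by
    rw [h.eq_fst x hx, map_neg, ← integral_conj]
    congr 2; ext t
    rw [map_mul, conj_exp_osc]
    simp
  eq_snd x hx := by
    rw [h.eq_snd x hx, map_mul, ← integral_conj]
    simp

/-- The solution of the Volterra equation, assembled from the forced problem with forcing `u`. -/
noncomputable def volterraSolution (lam : ℝ) (u : ℝ → ℝ) (x : ℝ) (k : ℂ) :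
    Matrix (Fin 2) (Fin 2) ℂ :=
  !![conj (1 + forcedSnd lam (fun t => (u t : ℂ)) (fun t => (u t : ℂ)) 0 x (conj k)),
      forcedFst lam (fun t => (u t : ℂ)) (fun t => (u t : ℂ)) 0 x k;
    lam * conj (forcedFst lam (fun t => (u t : ℂ)) (fun t => (u t : ℂ)) 0 x (conj k)),
      1 + forcedSnd lam (fun t => (u t : ℂ)) (fun t => (u t : ℂ)) 0 x k]

theorem isVolterraSolution_volterraSolution (hl : |lam| = 1)
    (hu : WeightedDiff n 0 (fun t => (u t : ℂ))) :
    IsVolterraSolution lam u (volterraSolution lam u) := by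
  have hl2 : (lam : ℂ) * lam = 1 := by
    rw [← Complex.ofReal_mul, ← abs_mul_abs_self, hl]; simp
  have hui := hu.integrableOn
  intro c k hk
  fin_cases c
  · have hk' : conj k ∈ closedLower := by
      have : 0 ≤ k.im := by simpa [columnDomain] using hk
      change (conj k).im ≤ 0
      simpa using this
    have h := isForcedSolution_forced hl hu hu hk'
    have hup := integrableOn_mul_bounded hui h.continuousOn_fst h.bounded_fst
    have huq := integrableOn_mul_bounded hui h.continuousOn_snd h.bounded_snd
    intro i
    fin_cases i
    · refine ⟨Complex.continuous_conj.comp_continuousOn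
        (continuousOn_const.add h.continuousOn_snd), fun x hx => ?_⟩
      simp only [Fin.zero_eta, Fin.isValue, volterraIntegrand_zero_zero, Matrix.one_apply_eq]
      have he : ∀ t, (u t : ℂ) * volterraSolution lam u t k 1 0 = lam * conj ((u t : ℂ) *
          forcedFst lam (fun t => (u t : ℂ)) (fun t => (u t : ℂ)) 0 t (conj k)) := by
        intro t
        simp only [volterraSolution, Matrix.of_apply, Matrix.cons_val', Matrix.cons_val_zero,
          Matrix.cons_val_one, Matrix.cons_val_fin_one, map_mul, Complex.conj_ofReal]
        ring
      simp only [he]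
      refine ⟨((integrableOn_conj hup).mono_set (Ioi_subset_Ioi hx)).const_mul _, ?_⟩
      change conj (1 + forcedSnd lam _ _ 0 x (conj k)) = _
      rw [h.eq_snd x hx, integral_const_mul, integral_conj]
      simp [sub_eq_add_neg]
    · refine ⟨continuousOn_const.mul (Complex.continuous_conj.comp_continuousOn
        h.continuousOn_fst), fun x hx => ?_⟩
      have he : ∀ t, volterraIntegrand lam u (volterraSolution lam u) k x t 1 0 = lam * conj
          (Complex.exp (-2 * Complex.I * conj k * (t - x : ℝ)) * ((u t : ℂ) *
          forcedSnd lam (fun t => (u t : ℂ)) (fun t => (u t : ℂ)) 0 t (conj k) + u t)) := by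
        intro t
        rw [volterraIntegrand_one_zero, map_mul, conj_exp_osc]
        simp only [volterraSolution, Matrix.of_apply, Matrix.cons_val', Matrix.cons_val_zero,
          Matrix.cons_val_fin_one, map_mul, map_add, map_one, Complex.conj_ofReal,
          Complex.conj_conj]
        ring
      simp only [Fin.mk_one, Fin.zero_eta, Fin.isValue, he]
      refine ⟨(integrableOn_conj (integrableOn_exp_mul (huq.add hui) hk' hx)).const_mul _, ?_⟩
      change (lam : ℂ) * conj (forcedFst lam _ _ 0 x (conj k)) = _
      rw [h.eq_fst x hx, integral_const_mul, integral_conj]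
      simp
  · have hk' : k ∈ closedLower := by simpa [columnDomain] using hk
    have h := isForcedSolution_forced hl hu hu hk'
    have hup := integrableOn_mul_bounded hui h.continuousOn_fst h.bounded_fst
    have huq := integrableOn_mul_bounded hui h.continuousOn_snd h.bounded_snd
    intro i
    fin_cases i
    · refine ⟨h.continuousOn_fst, fun x hx => ?_⟩
      have he : ∀ t, volterraIntegrand lam u (volterraSolution lam u) k x t 0 1 =
          Complex.exp (-2 * Complex.I * k * (t - x : ℝ)) * ((u t : ℂ) *
          forcedSnd lam (fun t => (u t : ℂ)) (fun t => (u t : ℂ)) 0 t k + u t) := by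
        intro t
        rw [volterraIntegrand_zero_one]
        simp only [volterraSolution, Matrix.of_apply, Matrix.cons_val', Matrix.cons_val_one,
          Matrix.cons_val_fin_one]
        ring
      simp only [Fin.mk_one, Fin.zero_eta, Fin.isValue, he]
      refine ⟨integrableOn_exp_mul (huq.add hui) hk' hx, ?_⟩
      change forcedFst lam _ _ 0 x k = _
      rw [h.eq_fst x hx]
      simp
    · refine ⟨continuousOn_const.add h.continuousOn_snd, fun x hx => ?_⟩
      simp only [Fin.mk_one, Fin.isValue, volterraIntegrand_one_one, Matrix.one_apply_eq]
      have he : ∀ t, volterraSolution lam u t k 0 1 =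
          forcedFst lam (fun t => (u t : ℂ)) (fun t => (u t : ℂ)) 0 t k := fun t => rfl
      simp only [he]
      refine ⟨(hup.mono_set (Ioi_subset_Ioi hx)).const_mul _, ?_⟩
      change 1 + forcedSnd lam _ _ 0 x k = _
      rw [h.eq_snd x hx, integral_const_mul]
      ring

end Columns

end HalfLineTransform

/-! ### Assembly of the theorem. -/

theorem theorem3p3 (lam : ℝ) (hlam : lam = 1 ∨ lam = -1) (u : ℝ → ℝ) (m n : ℕ)
    (hm : 1 ≤ m) (hn : 1 ≤ n)
    (hu : ContDiffOn ℝ ((m + 1 : ℕ) : WithTop ℕ∞) u (Set.Ici 0))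
    (hint : ∀ i ≤ m + 1, MeasureTheory.IntegrableOn
      (fun x : ℝ => (1 + x) ^ n * iteratedDerivWithin i u (Set.Ici 0) x) (Set.Ici 0)) :
    -- the Volterra equation determines `X`
    (∃ X, HalfLineTransform.IsVolterraSolution lam u X) ∧
    (∀ X X', HalfLineTransform.IsVolterraSolution lam u X →
      HalfLineTransform.IsVolterraSolution lam u X' →
      ∀ c : Fin 2, ∀ k ∈ HalfLineTransform.columnDomain c, ∀ x : ℝ, 0 ≤ x → ∀ i : Fin 2,
        X x k i c = X' x k i c) ∧
    ∀ X, HalfLineTransform.IsVolterraSolution lam u X →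
      ∀ a b : ℂ → ℂ, a = HalfLineTransform.spectralA X → b = HalfLineTransform.spectralB X →
      -- the first column of `s(k) = X(0, k)` is expressed through `a` and `b`
      (∀ k : ℂ, 0 ≤ k.im →
        X 0 k 0 0 = conj (a (conj k)) ∧ X 0 k 1 0 = (lam : ℂ) * conj (b (conj k))) ∧
      -- (a)
      (ContinuousOn a HalfLineTransform.closedLower ∧
        ContinuousOn b HalfLineTransform.closedLower ∧
        AnalyticOnNhd ℂ a HalfLineTransform.openLower ∧
        AnalyticOnNhd ℂ b HalfLineTransform.openLower) ∧
      -- (b) and (c)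
      (∃ ca cb : ℕ → ℂ,
        HalfLineTransform.HasDifferentiableExpansion a 1 ca m n ∧
        HalfLineTransform.HasDifferentiableExpansion b 0 cb m n) ∧
      -- (d)
      (∀ k : ℂ, k.im ≤ 0 → a k = conj (a (-conj k)) ∧ b k = conj (b (-conj k))) ∧
      -- (e)
      (∀ k : ℝ, ‖a (k : ℂ)‖ ^ 2 - lam * ‖b (k : ℂ)‖ ^ 2 = 1) ∧
      -- (f)
      (lam = 1 → ∀ k : ℂ, k.im ≤ 0 → a k ≠ 0) := by

  have hl : |lam| = 1 := by rcases hlam with rfl | rfl <;> simp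
  have hl2 : (lam : ℂ) * lam = 1 := by
    rw [← Complex.ofReal_mul, ← abs_mul_abs_self, hl]; simp
  have hw : HalfLineTransform.WeightedDiff n (m + 1) (fun t => (u t : ℂ)) :=
    HalfLineTransform.weightedDiff_of_contDiffOn hu hint
  have hui := hw.integrableOn
  have huc := hw.continuousOn
  have hsol := fun (k : ℂ) (hk : k ∈ HalfLineTransform.closedLower) =>
    HalfLineTransform.isForcedSolution_forced hl hw.zero hw.zero hk
  have hconj : ∀ k : ℂ, 0 ≤ k.im → conj k ∈ HalfLineTransform.closedLower := by
    intro k hk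
    change (conj k).im ≤ 0
    simpa using hk
  refine ⟨⟨_, HalfLineTransform.isVolterraSolution_volterraSolution hl hw.zero⟩, ?_, ?_⟩
  · intro X X' hX hX' c k hk x hx i
    have hcol : ∀ c i : Fin 2, ∀ k ∈ HalfLineTransform.columnDomain c, X x k i c = X' x k i c := by
      intro c i k hk
      fin_cases c
      · have hk' := hconj k (by simpa [HalfLineTransform.columnDomain] using hk)
        have h := (hX.first_column hui hl hk').unique hl huc hui hui hk'
          (hX'.first_column hui hl hk') hx
        simp only [Complex.conj_conj, sub_left_inj] at h
        fin_cases i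
        · exact (starRingEnd ℂ).injective h.2
        · exact (starRingEnd ℂ).injective (mul_left_cancel₀ (left_ne_zero_of_mul_eq_one hl2) h.1)
      · have hk' : k ∈ HalfLineTransform.closedLower := by
          simpa [HalfLineTransform.columnDomain] using hk
        have h := (hX.second_column hui hl hk').unique hl huc hui hui hk'
          (hX'.second_column hui hl hk') hx
        simp only [sub_left_inj] at h
        fin_cases i
        · exact h.1
        · exact h.2
    exact hcol c i k hk
  · intro X hX a b ha hb
    have hsec := fun (k : ℂ) (hk : k ∈ HalfLineTransform.closedLower) =>
      hX.second_column hui hl hk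
    -- By uniqueness, any solution `X` has the spectral functions given by the Neumann series, so
    -- their regularity can be read off the series.
    have hba : ∀ k ∈ HalfLineTransform.closedLower,
        b k = HalfLineTransform.forcedFst lam (fun t => (u t : ℂ)) (fun t => (u t : ℂ)) 0 0 k ∧
        a k = 1 + HalfLineTransform.forcedSnd lam (fun t => (u t : ℂ)) (fun t => (u t : ℂ))
          0 0 k := by
      intro k hk
      obtain ⟨h1, h2⟩ := (hsec k hk).unique hl huc hui hui hk (hsol k hk) le_rfl
      rw [hb, ha]
      exact ⟨h1, by rw [← h2, HalfLineTransform.spectralA]; ring⟩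
    obtain ⟨C, hJ1, hJ2⟩ := HalfLineTransform.exists_jetFamily_forced hl hw.zero hw.zero
    have hen : ∀ k ∈ HalfLineTransform.closedLower,
        HalfLineTransform.energy lam (fun x => X x k 0 1) (fun x => X x k 1 1 - 1) 0 =
          ‖a k‖ ^ 2 - lam * ‖b k‖ ^ 2 := by
      intro k _
      rw [HalfLineTransform.energy, add_sub_cancel, Complex.normSq_eq_norm_sq,
        Complex.normSq_eq_norm_sq, ha, hb]
      rfl
    have hac : ContinuousOn a HalfLineTransform.closedLower :=
      (continuousOn_const.add (hJ2.continuousOn_param 0 (Nat.zero_le _) 0 le_rfl)).congr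
        fun k hk => (hba k hk).2
    have hbc : ContinuousOn b HalfLineTransform.closedLower :=
      (hJ1.continuousOn_param 0 (Nat.zero_le _) 0 le_rfl).congr fun k hk => (hba k hk).1
    refine ⟨fun k hk => ?_, ⟨hac, hbc, ?_, ?_⟩, ?_, fun k hk => ?_, fun k => ?_, ?_⟩
    · have hk' := hconj k hk
      obtain ⟨h1, h2⟩ := (hX.first_column hui hl hk').unique hl huc hui hui hk' (hsec _ hk') le_rfl
      simp only [Complex.conj_conj, sub_left_inj] at h1 h2
      rw [ha, hb, HalfLineTransform.spectralA, HalfLineTransform.spectralB, ← h1, ← h2]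
      simp only [map_mul, Complex.conj_conj, Complex.conj_ofReal, true_and]
      rw [← mul_assoc, hl2, one_mul]
    · refine DifferentiableOn.analyticOnNhd (fun k hk => ?_) HalfLineTransform.isOpen_openLower
      -- The first derivative belongs to the controlled family because `1 ≤ n`.
      refine ((((hJ2.hasDerivAt 0 hn 0 le_rfl k hk).const_add
        1).differentiableAt.differentiableWithinAt)).congr ?_ ?_
      · exact fun z hz => (hba z (HalfLineTransform.openLower_subset hz)).2
      · exact (hba k (HalfLineTransform.openLower_subset hk)).2
    · refine DifferentiableOn.analyticOnNhd (fun k hk => ?_) HalfLineTransform.isOpen_openLower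
      refine (((hJ1.hasDerivAt 0 hn 0 le_rfl k
        hk).differentiableAt.differentiableWithinAt)).congr ?_ ?_
      · exact fun z hz => (hba z (HalfLineTransform.openLower_subset hz)).1
      · exact (hba k (HalfLineTransform.openLower_subset hk)).1
    -- All `m + 1` derivatives of `u` are spent on the expansion. The last forcing `h` keeps only
    -- its weighted integrability, which is enough for `n` bounded `k`-derivatives of the remainder.
    · obtain ⟨h, hh, c, α, β, hexp⟩ := HalfLineTransform.forced_expansion hl hw hw
      obtain ⟨C', hJ1', hJ2'⟩ := HalfLineTransform.exists_jetFamily_forced hl hw.zero hh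
      exact ⟨_, _, hJ2.hasDifferentiableExpansion hJ2' (fun k hk => (hba k hk).2)
          fun k hk hk0 => (hexp k hk hk0).2,
        hJ1.hasDifferentiableExpansion hJ1' (fun k hk => by rw [(hba k hk).1, zero_add])
          fun k hk hk0 => (hexp k hk hk0).1⟩
    · have hk' : -conj k ∈ HalfLineTransform.closedLower := by
        change (-conj k).im ≤ 0
        simpa using hk
      obtain ⟨h1, h2⟩ := (hsec k hk).unique hl huc hui hui hk (hsec _ hk').conj le_rfl
      simp only [map_sub, map_one, sub_left_inj] at h2
      rw [ha, hb]
      exact ⟨h2, h1⟩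
    · have hk' : (k : ℂ) ∈ HalfLineTransform.closedLower := le_of_eq (Complex.ofReal_im k)
      rw [← hen _ hk']
      exact HalfLineTransform.energy_eq_one (hsec _ hk') huc hui (Complex.ofReal_im k)
    · intro hl1 k hk hak
      have h := HalfLineTransform.one_le_energy (hsec k hk) huc hui hk (by rw [hl1, one_mul]; exact hk)
      rw [hen k hk, hak, hl1, norm_zero] at h
      -- At a zero of `a` the energy bound would read `1 ≤ -‖b k‖²`.
      nlinarith [sq_nonneg ‖b k‖]
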